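/- Let $(\Omega,d,\mu)$ be an $RD$-space: a metric space with a Borel measure $\mu$ such that $0<\mu(B(x,r))<\infty$ for every open ball, $\mu(\{x\})=0$ for all $x$, and there are constants $0<C_1\le 1\le C_2$, $0<k\le n$ with $C_1\lambda^k\mu(B(x,r))\le\mu(B(x,\lambda r))\le C_2\lambda^n\mu(B(x,r))$ for all $x\in\Omega$, $r>0$, $\lambda\ge1$. Functions on $\Omega$ are real-valued, measurable and identified when equal a.e. Let $X$ be a rearrangement invariant (r.i.) Banach function space with the Fatou property on $\Omega$, let $1\le p<\infty$, and let $X^{(p)}=\{f:|f|^p\in X\}$ with $\|f\|_{X^{(p)}}=\||f|^p\|_X^{1/p}$. Let $E$ be a parameter, that is, an r.i. space (again with the Fatou property) on $(0,\infty)$ with Lebesgue measure, and let $\tilde E$ be the corresponding r.i. space on $(0,\infty)$ with the measure $dt/t$, i.e. $\|\varphi\|_{\tilde E}=\|\varphi^*\|_E$, where $\varphi^*$ is the decreasing rearrangement of $\varphi$ with respect to $dt/t$; put $\|\varphi\|_{\tilde E(0,1)}=\|\varphi\chi_{(0,1)}\|_{\tilde E}$. Let $b$ be slowly varying: $b:(0,\infty)\to(0,\infty)$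 is Lebesgue measurable and, for every $\varepsilon>0$, $t^{\varepsilon}b(t)$ is equivalent (up to constant factors) to an increasing function and $t^{-\varepsilon}b(t)$ to a decreasing function on $(0,\infty)$. Let $0<\theta<1$. Write $Y=X^{(p)}$ and $$E_Y(f,t)=\Big\|\,x\mapsto\frac1{\mu(B(x,t))}\int_{B(x,t)}|f(x)-f(y)|\,d\mu(y)\Big\|_Y .$$ The generalised homogeneous Hajłasz–Besov space $\mathring B^{\theta,b}_{Y,E}$ is the set of $f\in L^1+L^\infty$ with $\|f\|_{\mathring B^{\theta,b}_{Y,E}}=\|t^{-\theta}b(t)E_Y(f,t)\|_{\tilde E}<\infty$, and $B^{\theta,b}_{Y,E}=\mathring B^{\theta,b}_{Y,E}\cap Y$ with the norm $\|t^{-\theta}b(t)E_Y(f,t)\|_{\tilde E(0,1)}+\|f\|_Y$. The homogeneous Hajłasz–Sobolev space $\mathring M^{1,Y}$ is the set of $f\in L^1+L^\infty$ with $\|f\|_{\mathring M^{1,Y}}=\inf_g\|g\|_Y<\infty$, the infimum being over measurable $g\ge0$ such that $|f(x)-f(y)|\le d(x,y)(g(x)+g(y))$ for all $x,y$ outside a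 $\mu$-null set, and $M^{1,Y}=\mathring M^{1,Y}\cap Y$ with $\|f\|_{M^{1,Y}}=\|f\|_Y+\|f\|_{\mathring M^{1,Y}}$. For a couple $(A_0,A_1)$ of (quasi-semi)normed spaces let $K(f,t;A_0,A_1)=\inf_{f=f_0+f_1}\{\|f_0\|_{A_0}+t\|f_1\|_{A_1}\}$, and let $(A_0,A_1)_{\theta,b,E}$ be the set of $f\in A_0+A_1$ with $\|f\|_{(A_0,A_1)_{\theta,b,E}}=\|t^{-\theta}b(t)K(f,t;A_0,A_1)\|_{\tilde E}<\infty$. Then $$\mathring B^{\theta,b}_{X^{(p)},E}=(X^{(p)},\mathring M^{1,X^{(p)}})_{\theta,b,E}\qquad\text{and}\qquad B^{\theta,b}_{X^{(p)},E}=(X^{(p)},M^{1,X^{(p)}})_{\theta,b,E},$$ in each case as sets and with equivalent (semi)norms. -/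

import Mathlib

open MeasureTheory Set Metric
open scoped ENNReal NNReal

noncomputable section

namespace HajlaszBesov

/-- `RD`-spaces: metric measure spaces whose balls have positive finite measure and for which
`C₁ l^k μ(B(x,r)) ≤ μ(B(x,l r)) ≤ C₂ l^n μ(B(x,r))` for all `x`, `r > 0`, `l ≥ 1`. -/
structure IsRDSpace {Ω : Type*} [MetricSpace Ω] [MeasurableSpace Ω] (μ : Measure Ω) : Prop where
  ball_pos : ∀ (x : Ω) (r : ℝ), 0 < r → 0 < μ (ball x r)
  ball_lt_top : ∀ (x : Ω) (r : ℝ), 0 < r → μ (ball x r) < ∞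
  growth : ∃ C₁ C₂ k n : ℝ, 0 < C₁ ∧ C₁ ≤ 1 ∧ 1 ≤ C₂ ∧ 0 < k ∧ k ≤ n ∧
    ∀ (x : Ω) (r l : ℝ), 0 < r → 1 ≤ l →
      C₁ * l ^ k * μ.real (ball x r) ≤ μ.real (ball x (l * r)) ∧
      μ.real (ball x (l * r)) ≤ C₂ * l ^ n * μ.real (ball x r)

/-- The decreasing rearrangement `f*(s) = inf {t ≥ 0 : μ {f > t} ≤ s}`, `s > 0`, of a function with
values in `[0, ∞]`. -/
def rearrangement {α : Type*} [MeasurableSpace α] (μ : Measure α) (f : α → ℝ≥0∞) (s : ℝ) : ℝ≥0∞ :=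
  sInf {t : ℝ≥0∞ | μ {x | t < f x} ≤ ENNReal.ofReal s}

/-- Banach function norms with the Fatou property, given as functionals on the non-negative
measurable functions (the values on non-measurable functions are irrelevant). The Banach function
space is `{f : ρ |f| < ∞}`. -/
structure IsBanachFunctionNorm {α : Type*} [MeasurableSpace α] (μ : Measure α)
    (ρ : (α → ℝ≥0∞) → ℝ≥0∞) : Prop where
  add_le : ∀ f g : α → ℝ≥0∞, Measurable f → Measurable g → ρ (f + g) ≤ ρ f + ρ g
  smul_eq : ∀ (a : ℝ≥0) (f : α → ℝ≥0∞), Measurable f → ρ (fun x => a * f x) = a * ρ f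
  eq_zero_iff : ∀ f : α → ℝ≥0∞, Measurable f → (ρ f = 0 ↔ f =ᵐ[μ] 0)
  mono : ∀ f g : α → ℝ≥0∞, Measurable f → Measurable g → f ≤ᵐ[μ] g → ρ f ≤ ρ g
  fatou : ∀ F : ℕ → α → ℝ≥0∞, (∀ n, Measurable (F n)) → Monotone F →
    ρ (fun x => ⨆ n, F n x) = ⨆ n, ρ (F n)
  indicator_lt_top : ∀ A : Set α, MeasurableSet A → μ A < ∞ → ρ (A.indicator 1) < ∞
  lintegral_le : ∀ A : Set α, MeasurableSet A → μ A < ∞ →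
    ∃ C : ℝ≥0, ∀ f : α → ℝ≥0∞, Measurable f → ∫⁻ x in A, f x ∂μ ≤ C * ρ f

/-- Rearrangement invariant (r.i.) function norms. -/
structure IsRINorm {α : Type*} [MeasurableSpace α] (μ : Measure α)
    (ρ : (α → ℝ≥0∞) → ℝ≥0∞) : Prop extends IsBanachFunctionNorm μ ρ where
  rearrangement_mono : ∀ f g : α → ℝ≥0∞, Measurable f → Measurable g →
    (∀ᵐ s ∂(volume.restrict (Ioi (0 : ℝ))), rearrangement μ f s ≤ rearrangement μ g s) →
    ρ f ≤ ρ g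

/-- The `p`-convexification `‖f‖_{X^{(p)}} = ‖|f|^p‖_X^{1/p}`. -/
def convexification {α : Type*} (X : (α → ℝ≥0∞) → ℝ≥0∞) (p : ℝ) (f : α → ℝ≥0∞) : ℝ≥0∞ :=
  X (fun x => f x ^ p) ^ (1 / p)

/-- A parameter: an r.i. space on `(0, ∞)` with Lebesgue measure. -/
def IsParameter (E : (ℝ → ℝ≥0∞) → ℝ≥0∞) : Prop :=
  IsRINorm (volume.restrict (Ioi (0 : ℝ))) E

/-- The homogeneous measure `dt / t` on `(0, ∞)`. -/
def homMeasure : Measure ℝ :=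
  (volume.restrict (Ioi (0 : ℝ))).withDensity (fun t => ENNReal.ofReal t⁻¹)

/-- The norm of `Ẽ`, the copy of `E` over `(0, ∞)` with `dt / t`: the `E`-norm of the decreasing
rearrangement with respect to `dt / t`. -/
def tildeNorm (E : (ℝ → ℝ≥0∞) → ℝ≥0∞) (φ : ℝ → ℝ≥0∞) : ℝ≥0∞ :=
  E (rearrangement homMeasure φ)

/-- `g` is almost increasing on `(0, ∞)`: equivalent to an increasing function. -/
def AlmostIncreasing (g : ℝ → ℝ) : Prop :=
  ∃ φ : ℝ → ℝ, MonotoneOn φ (Ioi 0) ∧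
    ∃ C : ℝ, 0 < C ∧ ∀ t : ℝ, 0 < t → φ t ≤ C * g t ∧ g t ≤ C * φ t

/-- `g` is almost decreasing on `(0, ∞)`: equivalent to a decreasing function. -/
def AlmostDecreasing (g : ℝ → ℝ) : Prop :=
  ∃ φ : ℝ → ℝ, AntitoneOn φ (Ioi 0) ∧
    ∃ C : ℝ, 0 < C ∧ ∀ t : ℝ, 0 < t → φ t ≤ C * g t ∧ g t ≤ C * φ t

/-- Slowly varying functions on `(0, ∞)`. -/
structure IsSlowlyVarying (b : ℝ → ℝ) : Prop where
  pos : ∀ t : ℝ, 0 < t → 0 < b t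
  measurable : AEMeasurable b (volume.restrict (Ioi (0 : ℝ)))
  almostIncreasing : ∀ ε : ℝ, 0 < ε → AlmostIncreasing (fun t => t ^ ε * b t)
  almostDecreasing : ∀ ε : ℝ, 0 < ε → AlmostDecreasing (fun t => t ^ (-ε) * b t)

/-- A subset of `V` together with its (quasi-semi)norm. Below every instance is explicit. -/
structure NormedSubset (V : Type*) where
  carrier : Set V
  nrm : V → ℝ≥0∞

/-- Equality of spaces with equivalent norms. -/
def NormedSubset.EqEquiv {V : Type*} (A B : NormedSubset V) : Prop :=
  A.carrier = B.carrier ∧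
    ∃ C : ℝ≥0, ∀ f ∈ A.carrier, A.nrm f ≤ C * B.nrm f ∧ B.nrm f ≤ C * A.nrm f

/-- Peetre's functional `K(f, t; A₀, A₁)`. -/
def peetreK {V : Type*} [Add V] (A₀ A₁ : NormedSubset V) (f : V) (t : ℝ) : ℝ≥0∞ :=
  ⨅ (f₀ ∈ A₀.carrier) (f₁ ∈ A₁.carrier) (_ : f = f₀ + f₁),
    A₀.nrm f₀ + ENNReal.ofReal t * A₁.nrm f₁

/-- The real interpolation space `(A₀, A₁)_{θ,b,E}`: all `f` in `A₀ + A₁` with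
`‖t^{-θ} b(t) K(f,t;A₀,A₁)‖_Ẽ < ∞`. -/
def realInterpolation {V : Type*} [Add V] (A₀ A₁ : NormedSubset V) (θ : ℝ) (b : ℝ → ℝ)
    (E : (ℝ → ℝ≥0∞) → ℝ≥0∞) : NormedSubset V where
  carrier := {f | (∃ f₀ ∈ A₀.carrier, ∃ f₁ ∈ A₁.carrier, f = f₀ + f₁) ∧
    tildeNorm E (fun t => ENNReal.ofReal (t ^ (-θ) * b t) * peetreK A₀ A₁ f t) < ∞}
  nrm f := tildeNorm E (fun t => ENNReal.ofReal (t ^ (-θ) * b t) * peetreK A₀ A₁ f t)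

section Spaces

variable {Ω : Type*} [MetricSpace Ω] [MeasurableSpace Ω]

/-- The function space `{f : ‖f‖_X < ∞}` of a function norm, modulo equality a.e. -/
def functionSpace (μ : Measure Ω) (X : (Ω → ℝ≥0∞) → ℝ≥0∞) : NormedSubset (Ω →ₘ[μ] ℝ) where
  carrier := {f | X (fun x => ‖f x‖ₑ) < ∞}
  nrm f := X (fun x => ‖f x‖ₑ)

/-- `g` is a `1`-gradient of `f`:
`|f(x) - f(y)| ≤ d(x,y) (g(x) + g(y))` for all `x, y` outside a null set. -/
def IsOneGradient (μ : Measure Ω) (f : Ω → ℝ) (g : Ω → ℝ≥0) : Prop :=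
  Measurable g ∧ ∃ N : Set Ω, μ N = 0 ∧
    ∀ x ∉ N, ∀ y ∉ N, |f x - f y| ≤ dist x y * (g x + g y)

/-- The homogeneous Hajłasz–Sobolev space: all `f ∈ L¹ + L^∞` for which the infimum of `‖g‖_X`
over the `1`-gradients `g` of `f` is finite. -/
def homHajlaszSobolev (μ : Measure Ω) (X : (Ω → ℝ≥0∞) → ℝ≥0∞) :
    NormedSubset (Ω →ₘ[μ] ℝ) where
  carrier := {f | f ∈ Lp ℝ 1 μ ⊔ Lp ℝ ∞ μ ∧
    (⨅ (g : Ω → ℝ≥0) (_ : IsOneGradient μ f g), X (fun x => g x)) < ∞}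
  nrm f := ⨅ (g : Ω → ℝ≥0) (_ : IsOneGradient μ f g), X (fun x => g x)

/-- The Hajłasz–Sobolev space: the intersection of `X` with the homogeneous one. -/
def hajlaszSobolev (μ : Measure Ω) (X : (Ω → ℝ≥0∞) → ℝ≥0∞) :
    NormedSubset (Ω →ₘ[μ] ℝ) where
  carrier := (homHajlaszSobolev μ X).carrier ∩ (functionSpace μ X).carrier
  nrm f := (functionSpace μ X).nrm f + (homHajlaszSobolev μ X).nrm f

/-- The `X`-modulus `E_X(f, t)`: the `X`-norm in `x` of the average over `y ∈ B(x, t)` of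
`|f(x) - f(y)|`. -/
def modulus (μ : Measure Ω) (X : (Ω → ℝ≥0∞) → ℝ≥0∞) (f : Ω → ℝ) (t : ℝ) : ℝ≥0∞ :=
  X (fun x => ⨍⁻ y in ball x t, ‖f x - f y‖ₑ ∂μ)

/-- The generalised homogeneous Hajłasz–Besov space: all `f ∈ L¹ + L^∞` with
`‖t^{-θ} b(t) E_X(f, t)‖_Ẽ < ∞`. -/
def homHajlaszBesov (μ : Measure Ω) (X : (Ω → ℝ≥0∞) → ℝ≥0∞) (θ : ℝ) (b : ℝ → ℝ)
    (E : (ℝ → ℝ≥0∞) → ℝ≥0∞) : NormedSubset (Ω →ₘ[μ] ℝ) where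
  carrier := {f | f ∈ Lp ℝ 1 μ ⊔ Lp ℝ ∞ μ ∧
    tildeNorm E (fun t => ENNReal.ofReal (t ^ (-θ) * b t) * modulus μ X f t) < ∞}
  nrm f := tildeNorm E (fun t => ENNReal.ofReal (t ^ (-θ) * b t) * modulus μ X f t)

/-- The generalised Hajłasz–Besov space: the intersection of `X` with the homogeneous one, with the
norm `‖t^{-θ} b(t) E_X(f, t)‖_{Ẽ(0,1)} + ‖f‖_X`. -/
def hajlaszBesov (μ : Measure Ω) (X : (Ω → ℝ≥0∞) → ℝ≥0∞) (θ : ℝ) (b : ℝ → ℝ)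
    (E : (ℝ → ℝ≥0∞) → ℝ≥0∞) : NormedSubset (Ω →ₘ[μ] ℝ) where
  carrier := (homHajlaszBesov μ X θ b E).carrier ∩ (functionSpace μ X).carrier
  nrm f := tildeNorm E ((Ioo (0 : ℝ) 1).indicator
      (fun t => ENNReal.ofReal (t ^ (-θ) * b t) * modulus μ X f t)) + (functionSpace μ X).nrm f

end Spaces

end HajlaszBesov

end

/-!
For a function `f` let `A_r(x)` be the mean of `|f(x) - f(y)|` over `y ∈ B(x, r)`, so that the
modulus `E_Y(f, r)` is the `Y`-norm of `A_r`. Since the `p`-convexification of an r.i. norm is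
again r.i. (`IsRINorm.convexification`), it suffices to treat an arbitrary r.i. space `Y`.
Everything follows from the two estimates
`E_Y(f, t) ≲ K(f, t; Y, M̊) ≲ ∑ l ^ (-j) E_Y(f, l ^ j t)`, the sum running over `j ≥ 0`, where
`l` is a large constant, and from a Hardy inequality
which says that passing from `E_Y` to the sum on the right does not increase the norm with weight
`t ^ (-θ) b(t)` in `Ẽ` by more than a factor.

The lower estimate (`IsRDSpace.exists_modulus_le_peetreK`) rests on the boundedness in `Y` of
averages over balls of a fixed radius (`IsRDSpace.exists_laverage_ball_le`). The usual argument
interpolates between `L¹` and `L^∞`; here a direct one is given. By doubling, ball averages are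
dominated by averages over a family of sets with bounded overlap, and, up to the
overlap constant, such an average is an increasing limit of functions lying below means of functions
whose distribution functions are at most that of the original function
(`IsRINorm.sample_mean_le`). These functions arise by cutting the cells, in
which the measure has no atoms, into equal parts and distributing samples of the local
rearrangements over them.

For the upper estimate (`IsRDSpace.exists_decomposition`), `f` is split by means of its smoothing
at the scale `t` with Lipschitz cones. The remainder is at most a multiple of `A_t`. For points at
distance less than `t` the increments of the smoothing are controlled by `A_{2t}`, and for points
at distance about `l ^ k t` they are controlled by the mean oscillations at that scale, so that
`t⁻¹ ∑ l ^ (-j) A_{l ^ j t}` is, up to a constant, a `1`-gradient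
(`IsRDSpace.exists_smoothing_le`).

In the Hardy inequality (`exists_hardy`), `Ẽ` is invariant under dilations, and the slow variation
of `b` gives the `j`-th term of the sum a geometrically decaying factor. The only triangle
inequality used for `Ẽ` is `tildeNorm_tsum_le`, where the `j`-th term costs a factor
`2 ^ (j + 1)`; the base `l` is taken so large that the decay wins.

In the inhomogeneous case the same estimates are applied with the modulus replaced by a multiple
of `‖f‖_Y` for `t ≥ 1`; there the weight `t ^ (-θ) b(t)` itself has finite norm
(`tildeNorm_tail_lt_top`), and `K(f, t; Y, M) ≥ ‖f‖_Y`.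
-/

noncomputable section

namespace HajlaszBesov

/-! ### Decreasing rearrangements and function norms -/

section Rearrangement

variable {α : Type*} [MeasurableSpace α] {μ : Measure α}

/-- The rearrangement and the distribution function are inverse to each other. No measurability is
needed, since measures are continuous along arbitrary increasing unions. -/
theorem lt_rearrangement_iff {f : α → ℝ≥0∞} {s : ℝ} {t : ℝ≥0∞} :
    t < rearrangement μ f s ↔ ENNReal.ofReal s < μ {x | t < f x} := by
  constructor
  · intro h
    by_contra! h'
    exact absurd (sInf_le h' : rearrangement μ f s ≤ t) (not_le.2 h)
  · intro h
    have ht : t < ∞ := by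
      by_contra! ht
      simp [top_le_iff.1 ht] at h
    obtain ⟨u, hu, hut, hlim⟩ := exists_seq_strictAnti_tendsto' ht
    have hU : {x | t < f x} = ⋃ n, {x | u n < f x} := by
      ext x
      simp only [mem_ofPred_eq, mem_iUnion]
      constructor
      · intro hx
        exact (hlim.eventually (gt_mem_nhds hx)).exists
      · rintro ⟨n, hn⟩
        exact (hut n).1.trans hn
    have hm : Monotone fun n => {x | u n < f x} :=
      fun m n hmn x hx => lt_of_le_of_lt (hu.antitone hmn) hx
    rw [hU, hm.measure_iUnion, lt_iSup_iff] at h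
    obtain ⟨n, hn⟩ := h
    refine (hut n).1.trans_le (le_sInf fun v hv => ?_)
    by_contra! hvn
    refine absurd hn (not_lt.2 (le_trans (measure_mono ?_) hv))
    exact fun x hx => hvn.trans hx

theorem rearrangement_le_iff {f : α → ℝ≥0∞} {s : ℝ} {t : ℝ≥0∞} :
    rearrangement μ f s ≤ t ↔ μ {x | t < f x} ≤ ENNReal.ofReal s := by
  rw [← not_lt, lt_rearrangement_iff, not_lt]

theorem antitone_rearrangement (f : α → ℝ≥0∞) : Antitone (rearrangement μ f) := by
  intro s s' h
  exact rearrangement_le_iff.2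
    ((rearrangement_le_iff.1 le_rfl).trans (ENNReal.ofReal_le_ofReal h))

theorem measurable_rearrangement (f : α → ℝ≥0∞) : Measurable (rearrangement μ f) :=
  (antitone_rearrangement f).measurable

theorem rearrangement_mono_of_distribution {β : Type*} [MeasurableSpace β] {ν : Measure β}
    {f : α → ℝ≥0∞} {g : β → ℝ≥0∞} (h : ∀ t, μ {x | t < f x} ≤ ν {x | t < g x}) (s : ℝ) :
    rearrangement μ f s ≤ rearrangement ν g s :=
  rearrangement_le_iff.2 ((h _).trans (rearrangement_le_iff.1 le_rfl))

theorem rearrangement_const_mul {f : α → ℝ≥0∞} {a : ℝ≥0∞} (ha0 : a ≠ 0) (ha : a ≠ ∞) (s : ℝ) :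
    rearrangement μ (fun x => a * f x) s = a * rearrangement μ f s := by
  refine eq_of_forall_lt_iff fun t => ?_
  rw [lt_rearrangement_iff, mul_comm, ← ENNReal.div_lt_iff (Or.inl ha0) (Or.inl ha),
    lt_rearrangement_iff]
  simp_rw [mul_comm a, ENNReal.div_lt_iff (Or.inl ha0) (Or.inl ha)]

theorem rearrangement_rpow {f : α → ℝ≥0∞} {p : ℝ} (hp : 0 < p) (s : ℝ) :
    rearrangement μ (fun x => f x ^ p) s = rearrangement μ f s ^ p := by
  refine eq_of_forall_lt_iff fun t => ?_
  rw [lt_rearrangement_iff, ← ENNReal.rpow_inv_lt_iff hp, lt_rearrangement_iff]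
  simp_rw [← ENNReal.rpow_inv_lt_iff hp]

/-- The rearrangement of a sum, with the allowance `s` distributed as `∑ s / 2 ^ (j + 1)`. -/
theorem rearrangement_tsum_le (φ : ℕ → α → ℝ≥0∞) {s : ℝ} (hs : 0 ≤ s) :
    rearrangement μ (fun x => ∑' j, φ j x) s ≤ ∑' j, rearrangement μ (φ j) (s / 2 ^ (j + 1)) := by
  rw [rearrangement_le_iff]
  have hsub : {x | ∑' j, rearrangement μ (φ j) (s / 2 ^ (j + 1)) < ∑' j, φ j x} ⊆
      ⋃ j, {x | rearrangement μ (φ j) (s / 2 ^ (j + 1)) < φ j x} := by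
    intro x hx
    by_contra hcon
    simp only [mem_iUnion, mem_ofPred_eq, not_exists, not_lt] at hcon hx
    exact absurd hx (not_lt.2 (ENNReal.tsum_le_tsum hcon))
  refine (measure_mono hsub).trans ((measure_iUnion_le _).trans ?_)
  refine (ENNReal.tsum_le_tsum fun j => rearrangement_le_iff.1 le_rfl).trans ?_
  have hsum : HasSum (fun j : ℕ => s / 2 ^ (j + 1)) s := by
    convert hasSum_geometric_two' s using 2 with j
    rw [pow_succ', div_div]
  rw [← ENNReal.ofReal_tsum_of_nonneg (fun j => by positivity) hsum.summable, hsum.tsum_eq]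

theorem volume_Ioi_lt_ofReal (c : ℝ≥0∞) :
    (volume.restrict (Ioi (0 : ℝ))) {s | ENNReal.ofReal s < c} = c := by
  rw [Measure.restrict_apply' measurableSet_Ioi]
  rcases eq_or_ne c ∞ with rfl | hc
  · simp [ENNReal.ofReal_lt_top]
  · have : {s : ℝ | ENNReal.ofReal s < c} ∩ Ioi 0 = Ioo 0 c.toReal := by
      ext s
      simp only [mem_inter_iff, mem_ofPred_eq, mem_Ioi, mem_Ioo, and_comm (b := (0 : ℝ) < s)]
      refine and_congr_right fun hs => ?_
      rw [ENNReal.ofReal_lt_iff_lt_toReal hs.le hc]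
    rw [this, Real.volume_Ioo, sub_zero, ENNReal.ofReal_toReal hc]

/-- A function and its rearrangement have the same distribution. -/
theorem volume_lt_rearrangement (f : α → ℝ≥0∞) (t : ℝ≥0∞) :
    (volume.restrict (Ioi (0 : ℝ))) {s | t < rearrangement μ f s} = μ {x | t < f x} := by
  simp_rw [lt_rearrangement_iff]
  exact volume_Ioi_lt_ofReal _

namespace IsBanachFunctionNorm

variable {ρ : (α → ℝ≥0∞) → ℝ≥0∞}

theorem map_zero (h : IsBanachFunctionNorm μ ρ) : ρ (fun _ => 0) = 0 :=
  (h.eq_zero_iff _ measurable_const).2 (by rfl)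

theorem const_mul (h : IsBanachFunctionNorm μ ρ) {a : ℝ≥0∞} (ha : a ≠ ∞) {f : α → ℝ≥0∞}
    (hf : Measurable f) : ρ (fun x => a * f x) = a * ρ f := by
  lift a to ℝ≥0 using ha
  exact h.smul_eq a f hf

theorem mono' (h : IsBanachFunctionNorm μ ρ) {f g : α → ℝ≥0∞} (hf : Measurable f)
    (hg : Measurable g) (hfg : ∀ x, f x ≤ g x) : ρ f ≤ ρ g :=
  h.mono f g hf hg (Filter.Eventually.of_forall hfg)

theorem congr_ae (h : IsBanachFunctionNorm μ ρ) {f g : α → ℝ≥0∞} (hf : Measurable f)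
    (hg : Measurable g) (hfg : f =ᵐ[μ] g) : ρ f = ρ g :=
  le_antisymm (h.mono f g hf hg hfg.le) (h.mono g f hg hf hfg.symm.le)

theorem sum_le (h : IsBanachFunctionNorm μ ρ) {ι : Type*} (s : Finset ι) {F : ι → α → ℝ≥0∞}
    (hF : ∀ j, Measurable (F j)) : ρ (fun x => ∑ j ∈ s, F j x) ≤ ∑ j ∈ s, ρ (F j) := by
  classical
  induction s using Finset.induction_on with
  | empty => simp [h.map_zero]
  | insert j s hj ih =>
    simp_rw [Finset.sum_insert hj]
    refine (h.add_le (F j) _ (hF j) (Finset.measurable_fun_sum s fun i _ => hF i)).trans ?_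
    gcongr

theorem tsum_le (h : IsBanachFunctionNorm μ ρ) {F : ℕ → α → ℝ≥0∞} (hF : ∀ j, Measurable (F j)) :
    ρ (fun x => ∑' j, F j x) ≤ ∑' j, ρ (F j) := by
  simp_rw [ENNReal.tsum_eq_iSup_nat]
  rw [h.fatou (fun n x => ∑ j ∈ Finset.range n, F j x)
    (fun n => Finset.measurable_fun_sum _ fun i _ => hF i)]
  · exact iSup_mono fun n => h.sum_le _ hF
  · intro m n hmn x
    exact Finset.sum_le_sum_of_subset (Finset.range_mono hmn)

/-- A function of finite norm is finite almost everywhere: on the set where it is infinite, all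
multiples of the indicator lie below it. -/
theorem ae_lt_top (h : IsBanachFunctionNorm μ ρ) {f : α → ℝ≥0∞} (hf : Measurable f)
    (hfin : ρ f < ∞) : ∀ᵐ x ∂μ, f x < ∞ := by
  set A := {x | f x = ∞} with hA
  have hAm : MeasurableSet A := hf (measurableSet_singleton ∞)
  have hind : Measurable (A.indicator (1 : α → ℝ≥0∞)) := measurable_one.indicator hAm
  have hle : ∀ n : ℕ, (n : ℝ≥0∞) * ρ (A.indicator 1) ≤ ρ f := by
    intro n
    rw [← h.const_mul (ENNReal.natCast_ne_top n) hind]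
    refine h.mono' (hind.const_mul _) hf fun x => ?_
    by_cases hx : x ∈ A
    · rw [show f x = ∞ from hx]; exact le_top
    · simp [hx]
  have hzero : ρ (A.indicator 1) = 0 := by
    by_contra hne
    obtain ⟨n, hn⟩ := ENNReal.exists_nat_mul_gt hne hfin.ne
    exact absurd (hle n) (not_le.2 hn)
  filter_upwards [(h.eq_zero_iff _ hind).1 hzero] with x hx
  by_contra! hcon
  have : x ∈ A := top_le_iff.1 hcon
  simp [this] at hx

end IsBanachFunctionNorm

theorem IsRINorm.le_of_distribution {ρ : (α → ℝ≥0∞) → ℝ≥0∞} (h : IsRINorm μ ρ)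
    {f g : α → ℝ≥0∞} (hf : Measurable f) (hg : Measurable g)
    (hfg : ∀ t, μ {x | t < f x} ≤ μ {x | t < g x}) : ρ f ≤ ρ g :=
  h.rearrangement_mono f g hf hg
    (Filter.Eventually.of_forall fun s => rearrangement_mono_of_distribution hfg s)

end Rearrangement

/-! ### The norm of `Ẽ` -/

/-- If `A ⊆ (h, ∞)` is disjoint from its translate by `-h`, then `A` fills at most half of each
interval `(0, x)`, so restricting `F(· / 2)` to `A` undoes the doubling of the distribution. -/
theorem IsParameter.dilate_indicator_le {E : (ℝ → ℝ≥0∞) → ℝ≥0∞} (hE : IsParameter E)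
    {F : ℝ → ℝ≥0∞} (hF : Antitone F) {A : Set ℝ} (hA : MeasurableSet A) {h : ℝ} (h0 : 0 < h)
    (hAh : ∀ x ∈ A, h < x) (hdisj : ∀ x ∈ A, x - h ∉ A) :
    E (A.indicator fun s => F (s / 2)) ≤ E F := by
  have hF2 : Measurable fun s => F (s / 2) := hF.measurable.comp (measurable_id.div_const 2)
  refine IsRINorm.le_of_distribution hE (hF2.indicator hA) hF.measurable fun t => ?_
  rw [Measure.restrict_apply' measurableSet_Ioi, Measure.restrict_apply' measurableSet_Ioi]
  set D : Set ℝ := A ∩ {s | t < F (s / 2)} with hD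
  have hDm : MeasurableSet D := hA.inter (measurableSet_lt measurable_const hF2)
  have hsub : {x | t < A.indicator (fun s => F (s / 2)) x} ∩ Ioi 0 ⊆ D := by
    rintro x ⟨hx, -⟩
    by_cases hxA : x ∈ A
    · exact ⟨hxA, by simpa [hxA] using hx⟩
    · simp [hxA] at hx
  refine (measure_mono hsub).trans ?_
  have hshift : volume ((fun x => x + h) ⁻¹' D) = volume D := measure_preimage_add_right _ _ _
  have hdis : Disjoint D ((fun x => x + h) ⁻¹' D) := by
    rw [Set.disjoint_left]
    intro x hx hx'
    exact hdisj _ hx'.1 (by simpa using hx.1)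
  have hunion : D ∪ (fun x => x + h) ⁻¹' D ⊆
      (fun x => (2⁻¹ : ℝ) * x) ⁻¹' ({x | t < F x} ∩ Ioi 0) := by
    rintro x (hx | hx)
    · refine ⟨?_, ?_⟩
      · have := hx.2
        simpa [div_eq_inv_mul] using this
      · have := hAh _ hx.1
        simp only [mem_Ioi]; linarith
    · have h1 := hAh _ hx.1
      refine ⟨?_, ?_⟩
      · have h2 : t < F ((x + h) / 2) := hx.2
        refine h2.trans_le (hF ?_)
        linarith
      · simp only [mem_Ioi]; linarith
  have key : volume D + volume D ≤ 2 * volume ({x | t < F x} ∩ Ioi 0) := by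
    calc volume D + volume D = volume (D ∪ (fun x => x + h) ⁻¹' D) := by
          rw [measure_union hdis ((measurable_id.add_const h) hDm), hshift]
      _ ≤ _ := measure_mono hunion
      _ = _ := by
          rw [Real.volume_preimage_mul_left (by norm_num)]
          norm_num
  rw [← two_mul] at key
  exact (ENNReal.mul_le_mul_iff_right (by norm_num) (by norm_num)).1 key

/-- Dilation by `2` is bounded on the decreasing functions of an r.i. space: away from `(0, h]`,
the function `F(· / 2)` splits into its restrictions to the cells `[kh, (k + 1)h)` with `k` even and
with `k` odd, and `h` tends to `0`. -/
theorem IsParameter.dilate_le {E : (ℝ → ℝ≥0∞) → ℝ≥0∞} (hE : IsParameter E)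
    {F : ℝ → ℝ≥0∞} (hF : Antitone F) : E (fun s => F (s / 2)) ≤ 2 * E F := by
  have hF2 : Measurable fun s => F (s / 2) := hF.measurable.comp (measurable_id.div_const 2)
  have hB := hE.toIsBanachFunctionNorm
  set u : ℕ → ℝ := fun n => 1 / ((n : ℝ) + 1) with hu
  have hu0 : ∀ n, 0 < u n := fun n => Nat.one_div_pos_of_nat
  set G : ℕ → ℝ → ℝ≥0∞ := fun n => (Ioi (u n)).indicator fun s => F (s / 2) with hG
  have hGm : ∀ n, Measurable (G n) := fun n => hF2.indicator measurableSet_Ioi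
  have hGle : ∀ n, E (G n) ≤ 2 * E F := by
    intro n
    set A : Set ℝ := {x | u n < x ∧ Even ⌊x / u n⌋} with hA
    set B : Set ℝ := {x | u n < x ∧ Odd ⌊x / u n⌋} with hB'
    have hfl : Measurable fun x : ℝ => ⌊x / u n⌋ := (measurable_id.div_const _).floor
    have hAm : MeasurableSet A := measurableSet_Ioi.inter
      (hfl (t := {k | Even k}) MeasurableSet.of_discrete)
    have hBm : MeasurableSet B := measurableSet_Ioi.inter
      (hfl (t := {k | Odd k}) MeasurableSet.of_discrete)
    have hsh : ∀ x, ⌊(x - u n) / u n⌋ = ⌊x / u n⌋ - 1 := by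
      intro x
      rw [sub_div, div_self (hu0 n).ne', Int.floor_sub_one]
    have hsum : ∀ x, G n x = (A.indicator (fun s => F (s / 2)) +
        B.indicator (fun s => F (s / 2))) x := by
      intro x
      by_cases hx : u n < x
      · rcases Int.even_or_odd ⌊x / u n⌋ with he | ho
        · have h1 : x ∈ A := ⟨hx, he⟩
          have h2 : x ∉ B := fun h => (Int.not_odd_iff_even.2 he) h.2
          simp [hG, hx, h1, h2]
        · have h1 : x ∈ B := ⟨hx, ho⟩
          have h2 : x ∉ A := fun h => (Int.not_even_iff_odd.2 ho) h.2
          simp [hG, hx, h1, h2]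
      · have h1 : x ∉ A := fun h => hx h.1
        have h2 : x ∉ B := fun h => hx h.1
        simp [hG, hx, h1, h2]
    rw [funext hsum, two_mul]
    refine (hB.add_le _ _ (hF2.indicator hAm) (hF2.indicator hBm)).trans (add_le_add ?_ ?_)
    · refine hE.dilate_indicator_le hF hAm (hu0 n) (fun x hx => hx.1) fun x hx hx' => ?_
      have h1 := hx'.2
      rw [hsh] at h1
      exact (Int.not_even_iff_odd.2 (hx.2.sub_odd odd_one)) h1
    · refine hE.dilate_indicator_le hF hBm (hu0 n) (fun x hx => hx.1) fun x hx hx' => ?_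
      have h1 := hx'.2
      rw [hsh] at h1
      exact (Int.not_odd_iff_even.2 (hx.2.sub_odd odd_one)) h1
  have hmono : Monotone G := by
    intro m n hmn x
    refine Set.indicator_le_indicator_of_subset ?_ (fun _ => zero_le) x
    exact Ioi_subset_Ioi (Nat.one_div_le_one_div hmn)
  have hae : (fun s => F (s / 2)) =ᵐ[volume.restrict (Ioi 0)] fun x => ⨆ n, G n x := by
    filter_upwards [ae_restrict_mem measurableSet_Ioi] with x hx
    refine le_antisymm ?_ (iSup_le fun n => ?_)
    · obtain ⟨n, hn⟩ := exists_nat_one_div_lt (show (0 : ℝ) < x from hx)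
      refine le_trans (le_of_eq ?_) (le_iSup _ n)
      have : u n < x := hn
      simp [hG, this]
    · exact Set.indicator_le_self' (fun _ _ => zero_le) x
  rw [hB.congr_ae hF2 (Measurable.iSup hGm) hae, hB.fatou G hGm hmono]
  exact iSup_le hGle

theorem IsParameter.dilate_pow_le {E : (ℝ → ℝ≥0∞) → ℝ≥0∞} (hE : IsParameter E)
    {F : ℝ → ℝ≥0∞} (hF : Antitone F) (j : ℕ) : E (fun s => F (s / 2 ^ j)) ≤ 2 ^ j * E F := by
  induction j with
  | zero => simp
  | succ j ih =>
    have hanti : Antitone fun s : ℝ => F (s / 2 ^ j) := fun s t hst => hF (by gcongr)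
    have := hE.dilate_le hanti
    calc E (fun s => F (s / 2 ^ (j + 1))) = E (fun s => F (s / 2 / 2 ^ j)) := by
          congr 1; ext s; rw [pow_succ', div_div]
      _ ≤ 2 * E (fun s => F (s / 2 ^ j)) := this
      _ ≤ 2 * (2 ^ j * E F) := by gcongr
      _ = _ := by rw [pow_succ', mul_assoc]

theorem homMeasure_Iic_zero : homMeasure (Iic 0) = 0 := by
  rw [homMeasure, withDensity_apply _ measurableSet_Iic,
    Measure.restrict_restrict measurableSet_Iic, Iic_inter_Ioi, Ioc_self, Measure.restrict_empty,
    lintegral_zero_measure]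

theorem homMeasure_lt_top_of_Icc {a b : ℝ} (ha : 0 < a) : homMeasure (Icc a b) < ∞ := by
  rw [homMeasure, withDensity_apply _ measurableSet_Icc]
  calc ∫⁻ t in Icc a b, ENNReal.ofReal t⁻¹ ∂volume.restrict (Ioi 0)
      ≤ ∫⁻ t in Icc a b, ENNReal.ofReal a⁻¹ ∂volume.restrict (Ioi 0) := by
        refine setLIntegral_mono measurable_const fun t ht => ?_
        exact ENNReal.ofReal_le_ofReal (inv_anti₀ ha ht.1)
    _ ≤ ENNReal.ofReal a⁻¹ * volume (Icc a b) := by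
        rw [setLIntegral_const]
        exact mul_le_mul_right (Measure.restrict_apply_le _ _) _
    _ < ∞ := by simp [ENNReal.mul_lt_top]

theorem homMeasure_Ico_pos {a b : ℝ} (ha : 0 < a) (hab : a < b) : homMeasure (Ico a b) ≠ 0 := by
  rw [homMeasure, withDensity_apply _ measurableSet_Ico,
    Measure.restrict_restrict measurableSet_Ico]
  have : Ico a b ∩ Ioi 0 = Ico a b := inter_eq_left.2 fun x hx => ha.trans_le hx.1
  rw [this]
  refine ((setLIntegral_pos_iff (by fun_prop)).2 ?_).ne'
  have h2 : (Function.support fun t : ℝ => ENNReal.ofReal t⁻¹) ∩ Ico a b = Ico a b :=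
    inter_eq_right.2 fun x hx => by
      have : 0 < x := ha.trans_le hx.1
      simp [Function.mem_support, this]
  rw [h2, Real.volume_Ico]
  simpa using hab

/-- Dilations preserve `dt / t`. -/
theorem measurePreserving_mul_left_homMeasure {c : ℝ} (hc : 0 < c) :
    MeasurePreserving (fun t => c * t) homMeasure homMeasure := by
  refine ⟨measurable_const_mul c, Measure.ext fun s hs => ?_⟩
  have hform : ∀ u : Set ℝ, MeasurableSet u → homMeasure u =
      ∫⁻ t, (u ∩ Ioi 0).indicator (fun t => ENNReal.ofReal t⁻¹) t := by
    intro u hu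
    rw [homMeasure, withDensity_apply _ hu, Measure.restrict_restrict hu,
      lintegral_indicator (hu.inter measurableSet_Ioi)]
  have hGm : Measurable ((s ∩ Ioi 0).indicator fun t : ℝ => ENNReal.ofReal t⁻¹) :=
    Measurable.indicator (by fun_prop) (hs.inter measurableSet_Ioi)
  have hpre : MeasurableSet ((fun t => c * t) ⁻¹' s) := measurable_const_mul c hs
  rw [Measure.map_apply (measurable_const_mul c) hs, hform _ hs, hform _ hpre]
  calc ∫⁻ t, ((fun t => c * t) ⁻¹' s ∩ Ioi 0).indicator (fun t => ENNReal.ofReal t⁻¹) t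
      = ∫⁻ t, ENNReal.ofReal c *
          (s ∩ Ioi 0).indicator (fun t : ℝ => ENNReal.ofReal t⁻¹) (c * t) := by
        congr 1
        ext t
        by_cases ht : c * t ∈ s ∩ Ioi 0
        · have ht' : t ∈ (fun t => c * t) ⁻¹' s ∩ Ioi 0 :=
            ⟨ht.1, (mul_pos_iff_of_pos_left hc).1 ht.2⟩
          rw [indicator_of_mem ht, indicator_of_mem ht', ← ENNReal.ofReal_mul hc.le]
          congr 1
          field_simp
        · have ht' : t ∉ (fun t => c * t) ⁻¹' s ∩ Ioi 0 :=
            fun h => ht ⟨h.1, mul_pos hc h.2⟩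
          rw [indicator_of_notMem ht, indicator_of_notMem ht', mul_zero]
    _ = ENNReal.ofReal c * ∫⁻ t, (s ∩ Ioi 0).indicator (fun t : ℝ => ENNReal.ofReal t⁻¹) t
          ∂(Measure.map (fun t => c * t) volume) := by
        rw [lintegral_map hGm (measurable_const_mul c), lintegral_const_mul]
        exact hGm.comp (measurable_const_mul c)
    _ = _ := by
        rw [Real.map_volume_mul_left hc.ne', lintegral_smul_measure, smul_eq_mul, ← mul_assoc,
          ← ENNReal.ofReal_mul hc.le, abs_of_pos (inv_pos.2 hc), mul_inv_cancel₀ hc.ne',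
          ENNReal.ofReal_one, one_mul]

/-- Monotonicity of the norm of `Ẽ`. As the rearrangement is always measurable, the functions need
not be. -/
theorem tildeNorm_mono {E : (ℝ → ℝ≥0∞) → ℝ≥0∞} (hE : IsParameter E) {φ ψ : ℝ → ℝ≥0∞}
    (h : ∀ t, 0 < t → φ t ≤ ψ t) : tildeNorm E φ ≤ tildeNorm E ψ := by
  refine hE.mono' (measurable_rearrangement _) (measurable_rearrangement _) ?_
  refine rearrangement_mono_of_distribution fun t => ?_
  have hsub : {x | t < φ x} ⊆ {x | t < ψ x} ∪ Iic 0 := by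
    intro x hx
    rcases lt_or_ge 0 x with h0 | h0
    · exact Or.inl (lt_of_lt_of_le hx (h x h0))
    · exact Or.inr h0
  refine (measure_mono hsub).trans ((measure_union_le _ _).trans ?_)
  rw [homMeasure_Iic_zero, add_zero]

theorem tildeNorm_zero {E : (ℝ → ℝ≥0∞) → ℝ≥0∞} (hE : IsParameter E) :
    tildeNorm E (fun _ => 0) = 0 := by
  have : rearrangement homMeasure (fun _ => 0) = fun _ => 0 := by
    ext s
    exact le_antisymm (rearrangement_le_iff.2 (by simp)) zero_le
  rw [tildeNorm, this, hE.map_zero]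

theorem tildeNorm_const_mul {E : (ℝ → ℝ≥0∞) → ℝ≥0∞} (hE : IsParameter E) {a : ℝ≥0∞} (ha : a ≠ ∞)
    (φ : ℝ → ℝ≥0∞) : tildeNorm E (fun t => a * φ t) = a * tildeNorm E φ := by
  rcases eq_or_ne a 0 with rfl | ha0
  · simp [tildeNorm_zero hE]
  · rw [tildeNorm, funext (rearrangement_const_mul ha0 ha)]
    exact hE.const_mul ha (measurable_rearrangement _)

/-- Dilations preserve the distribution function with respect to `dt / t`, hence the norm of `Ẽ`. -/
theorem tildeNorm_dilate (E : (ℝ → ℝ≥0∞) → ℝ≥0∞) (φ : ℝ → ℝ≥0∞) {c : ℝ} (hc : 0 < c) :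
    tildeNorm E (fun t => φ (c * t)) = tildeNorm E φ := by
  have hemb : MeasurableEmbedding fun t : ℝ => c * t :=
    (MeasurableEquiv.mulLeft₀ c hc.ne').measurableEmbedding
  have : ∀ t, homMeasure {x | t < φ (c * x)} = homMeasure {x | t < φ x} := fun t =>
    (measurePreserving_mul_left_homMeasure hc).measure_preimage_emb hemb {x | t < φ x}
  simp_rw [tildeNorm]
  congr 1
  ext s
  simp_rw [rearrangement, this]

/-- A countable triangle inequality, with constants that grow because the rearrangement is only
subadditive at the price of dilations. -/
theorem tildeNorm_tsum_le {E : (ℝ → ℝ≥0∞) → ℝ≥0∞} (hE : IsParameter E) (φ : ℕ → ℝ → ℝ≥0∞) :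
    tildeNorm E (fun t => ∑' j, φ j t) ≤ ∑' j, 2 ^ (j + 1) * tildeNorm E (φ j) := by
  have hm : ∀ j : ℕ, Measurable fun s : ℝ => rearrangement homMeasure (φ j) (s / 2 ^ (j + 1)) :=
    fun j => (measurable_rearrangement _).comp (measurable_id.div_const _)
  calc tildeNorm E (fun t => ∑' j, φ j t)
      ≤ E (fun s => ∑' j, rearrangement homMeasure (φ j) (s / 2 ^ (j + 1))) := by
        refine hE.mono _ _ (measurable_rearrangement _) (Measurable.tsum hm) ?_
        filter_upwards [ae_restrict_mem measurableSet_Ioi] with s hs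
        exact rearrangement_tsum_le φ (le_of_lt hs)
    _ ≤ ∑' j, E (fun s => rearrangement homMeasure (φ j) (s / 2 ^ (j + 1))) := hE.tsum_le hm
    _ ≤ _ := ENNReal.tsum_le_tsum fun j => hE.dilate_pow_le (antitone_rearrangement _) _

theorem tildeNorm_add_le {E : (ℝ → ℝ≥0∞) → ℝ≥0∞} (hE : IsParameter E) (φ ψ : ℝ → ℝ≥0∞) :
    tildeNorm E (fun t => φ t + ψ t) ≤ 4 * (tildeNorm E φ + tildeNorm E ψ) := by
  have h := tildeNorm_tsum_le hE fun j => if j = 0 then φ else if j = 1 then ψ else fun _ => 0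
  have h1 : ∀ a b : ℝ≥0∞, ∑' j : ℕ, (if j = 0 then a else if j = 1 then b else 0) = a + b := by
    intro a b
    rw [tsum_eq_sum (s := Finset.range 2)]
    · simp [Finset.sum_range_succ]
    · intro j hj
      simp at hj
      rw [if_neg (by omega), if_neg (by omega)]
  calc tildeNorm E (fun t => φ t + ψ t) ≤ 2 * tildeNorm E φ + 4 * tildeNorm E ψ := by
        convert h using 1
        · congr 1; ext t
          rw [← h1 (φ t) (ψ t)]
          congr 1; ext j; split_ifs <;> rfl
        · rw [← h1]
          congr 1; ext j; split_ifs with h0 h1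
          · simp [h0]
          · simp [h1]; norm_num
          · simp [tildeNorm_zero hE]
    _ ≤ 4 * tildeNorm E φ + 4 * tildeNorm E ψ := by gcongr; norm_num
    _ = _ := by ring

/-- A function on `(0, ∞)` of finite norm in `Ẽ` is finite almost everywhere. -/
theorem homMeasure_eq_top {E : (ℝ → ℝ≥0∞) → ℝ≥0∞} (hE : IsParameter E) {φ : ℝ → ℝ≥0∞}
    (h : tildeNorm E φ < ∞) : homMeasure {t | φ t = ∞} = 0 := by
  have hae := hE.ae_lt_top (measurable_rearrangement _) h
  rw [ae_iff] at hae
  rw [← volume_Ioi_lt_ofReal (homMeasure {t | φ t = ∞})]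
  refine measure_mono_null (fun s hs => ?_) hae
  simp only [mem_ofPred_eq, not_lt, top_le_iff] at hs ⊢
  refine ENNReal.eq_top_of_forall_nnreal_le fun r => le_of_lt ?_
  rw [lt_rearrangement_iff]
  refine hs.trans_le (measure_mono fun t ht => ?_)
  simp only [mem_ofPred_eq] at ht ⊢
  simp [ht]

theorem rearrangement_indicator_one {α : Type*} [MeasurableSpace α] (μ : Measure α) (A : Set α) :
    rearrangement μ (A.indicator 1) = {s | ENNReal.ofReal s < μ A}.indicator 1 := by
  ext s
  refine eq_of_forall_lt_iff fun t => ?_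
  rw [lt_rearrangement_iff]
  rcases lt_or_ge t 1 with ht | ht
  · have : {x | t < A.indicator 1 x} = A := by
      ext x
      by_cases hx : x ∈ A <;> simp [hx, ht]
    rw [this]
    by_cases hs : ENNReal.ofReal s < μ A <;> simp [hs, ht]
  · have : {x | t < A.indicator 1 x} = ∅ := by
      ext x
      by_cases hx : x ∈ A <;> simp [hx, ht]
    rw [this]
    by_cases hs : ENNReal.ofReal s < μ A <;> simp [hs, ht]

theorem measurableSet_ofReal_lt (c : ℝ≥0∞) : MeasurableSet {s : ℝ | ENNReal.ofReal s < c} :=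
  measurableSet_lt ENNReal.measurable_ofReal measurable_const

theorem tildeNorm_indicator_one_lt_top {E : (ℝ → ℝ≥0∞) → ℝ≥0∞} (hE : IsParameter E) {A : Set ℝ}
    (hA : homMeasure A < ∞) : tildeNorm E (A.indicator 1) < ∞ := by
  rw [tildeNorm, rearrangement_indicator_one]
  refine hE.indicator_lt_top _ (measurableSet_ofReal_lt _) ?_
  rwa [volume_Ioi_lt_ofReal]

theorem tildeNorm_indicator_one_ne_zero {E : (ℝ → ℝ≥0∞) → ℝ≥0∞} (hE : IsParameter E) {A : Set ℝ}
    (hA : homMeasure A ≠ 0) : tildeNorm E (A.indicator 1) ≠ 0 := by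
  rw [tildeNorm, rearrangement_indicator_one, Ne, hE.eq_zero_iff _
    (measurable_one.indicator (measurableSet_ofReal_lt _))]
  intro h
  rw [indicator_ae_eq_zero, Function.support_one, inter_univ, volume_Ioi_lt_ofReal] at h
  exact hA h

/-! ### Slowly varying weights and a Hardy inequality -/

section Weights

variable {b : ℝ → ℝ} {E : (ℝ → ℝ≥0∞) → ℝ≥0∞}

theorem AlmostIncreasing.exists_le_mul {g : ℝ → ℝ} (h : AlmostIncreasing g) :
    ∃ C : ℝ, 0 < C ∧ ∀ s t, 0 < s → s ≤ t → g s ≤ C * g t := by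
  obtain ⟨φ, hφ, C, hC, hg⟩ := h
  refine ⟨C * C, by positivity, fun s t hs hst => ?_⟩
  have ht := hs.trans_le hst
  calc g s ≤ C * φ s := (hg s hs).2
    _ ≤ C * φ t := by gcongr; exact hφ hs ht hst
    _ ≤ C * (C * g t) := by gcongr; exact (hg t ht).1
    _ = _ := by ring

theorem AlmostDecreasing.exists_le_mul {g : ℝ → ℝ} (h : AlmostDecreasing g) :
    ∃ C : ℝ, 0 < C ∧ ∀ s t, 0 < s → s ≤ t → g t ≤ C * g s := by
  obtain ⟨φ, hφ, C, hC, hg⟩ := h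
  refine ⟨C * C, by positivity, fun s t hs hst => ?_⟩
  have ht := hs.trans_le hst
  calc g t ≤ C * φ t := (hg t ht).2
    _ ≤ C * φ s := by gcongr; exact hφ hs ht hst
    _ ≤ C * (C * g s) := by gcongr; exact (hg s hs).1
    _ = _ := by ring

/-- The weight `t ^ (-θ) b(t)` decreases under dilation by `l ≥ 1` at most by a factor
comparable to `l ^ (-(δ + θ))`. -/
theorem IsSlowlyVarying.weight_le_dilate (hb : IsSlowlyVarying b) (θ : ℝ) {δ : ℝ} (hδ : 0 < δ) :
    ∃ C : ℝ, 0 < C ∧ ∀ t l : ℝ, 0 < t → 1 ≤ l →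
      t ^ (-θ) * b t ≤ C * l ^ (δ + θ) * ((l * t) ^ (-θ) * b (l * t)) := by
  obtain ⟨C, hC, h⟩ := (hb.almostIncreasing δ hδ).exists_le_mul
  refine ⟨C, hC, fun t l ht hl => ?_⟩
  have hl0 : 0 < l := by linarith
  have h1 := h t (l * t) ht (le_mul_of_one_le_left ht.le hl)
  rw [Real.mul_rpow hl0.le ht.le] at h1 ⊢
  have h2 : b t ≤ C * l ^ δ * b (l * t) := by
    have htd : 0 < t ^ δ := Real.rpow_pos_of_pos ht _
    refine le_of_mul_le_mul_left ?_ htd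
    calc t ^ δ * b t ≤ _ := h1
      _ = _ := by ring
  calc t ^ (-θ) * b t ≤ t ^ (-θ) * (C * l ^ δ * b (l * t)) := by gcongr
    _ = C * l ^ (δ + θ) * (l ^ (-θ) * t ^ (-θ) * b (l * t)) := by
      rw [Real.rpow_add hl0]
      have : l ^ θ * l ^ (-θ) = 1 := by rw [← Real.rpow_add hl0]; simp
      linear_combination (- C * l ^ δ * t ^ (-θ) * b (l * t)) * this

theorem tsum_two_pow_succ_mul_inv_four_pow :
    ∑' j : ℕ, (2 : ℝ≥0∞) ^ (j + 1) * (4⁻¹) ^ j = 4 := by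
  have h : ∀ j : ℕ, (2 : ℝ≥0∞) ^ (j + 1) * (4⁻¹) ^ j = 2 * 2⁻¹ ^ j := by
    intro j
    rw [pow_succ', mul_assoc, ← mul_pow]
    congr 2
    rw [show (4 : ℝ≥0∞) = 2 * 2 by norm_num, ENNReal.mul_inv (by simp) (by simp), ← mul_assoc,
      ENNReal.mul_inv_cancel (by simp) (by simp), one_mul]
  simp_rw [h]
  rw [ENNReal.tsum_mul_left, ENNReal.tsum_geometric]
  simp only [ENNReal.one_sub_inv_two, inv_inv]
  norm_num

/-- Geometrically decaying superpositions of dilates are bounded: the decay `4 ^ (-j)` beats the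
constants `2 ^ (j + 1)` of the countable triangle inequality. -/
theorem tildeNorm_tsum_dilate_le (hE : IsParameter E) (φ : ℝ → ℝ≥0∞) {l : ℕ → ℝ}
    (hl : ∀ j, 0 < l j) :
    tildeNorm E (fun t => ∑' j, (4⁻¹ : ℝ≥0∞) ^ j * φ (l j * t)) ≤ 4 * tildeNorm E φ := by
  have h4 : ∀ j : ℕ, (4⁻¹ : ℝ≥0∞) ^ j ≠ ∞ := fun j => by simp
  refine (tildeNorm_tsum_le hE fun j t => (4⁻¹ : ℝ≥0∞) ^ j * φ (l j * t)).trans (le_of_eq ?_)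
  simp_rw [tildeNorm_const_mul hE (h4 _) fun t => φ (l _ * t), fun j => tildeNorm_dilate E φ (hl j),
    ← mul_assoc]
  rw [ENNReal.tsum_mul_right, tsum_two_pow_succ_mul_inv_four_pow]

/-- The Hardy inequality for the discrete averages `∑ l ^ (-j) e (l ^ j t)`, for a base `l` large in
terms of `1 - θ`. -/
theorem exists_hardy (hE : IsParameter E) (hb : IsSlowlyVarying b) {θ : ℝ} (hθ : θ < 1)
    (hθ0 : 0 < θ) :
    ∃ l : ℝ, 2 ≤ l ∧ ∃ C : ℝ≥0, ∀ e : ℝ → ℝ≥0∞,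
      tildeNorm E (fun t => ENNReal.ofReal (t ^ (-θ) * b t) *
        ∑' j : ℕ, ENNReal.ofReal ((l ^ j)⁻¹) * e (l ^ j * t)) ≤
      C * tildeNorm E (fun t => ENNReal.ofReal (t ^ (-θ) * b t) * e t) := by
  set δ : ℝ := (1 - θ) / 2 with hδ
  have hδ0 : 0 < δ := by linarith
  obtain ⟨C, hC, h⟩ := hb.weight_le_dilate θ hδ0
  -- with this base, dilation by `l ^ j` gains the factor `4 ^ (-j)`
  set l : ℝ := 4 ^ (1 / δ) with hl
  have hlδ : l ^ (-δ) = 4⁻¹ := by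
    rw [hl, ← Real.rpow_mul (by norm_num), one_div, mul_neg, inv_mul_cancel₀ hδ0.ne',
      Real.rpow_neg_one]
  have hl4 : 4 ≤ l := by
    have : (4 : ℝ) ^ (1 : ℝ) ≤ 4 ^ (1 / δ) := by
      refine Real.rpow_le_rpow_of_exponent_le (by norm_num) ?_
      rw [le_div_iff₀ hδ0]; linarith
    rwa [Real.rpow_one] at this
  refine ⟨l, by linarith, 4 * C.toNNReal, fun e => ?_⟩
  have hl0 : 0 < l := by linarith
  have hlj : ∀ j : ℕ, 0 < l ^ j := fun j => by positivity
  set Ψ : ℝ → ℝ≥0∞ := fun t => ENNReal.ofReal (t ^ (-θ) * b t) * e t with hΨ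
  have hpt : ∀ t, 0 < t → ENNReal.ofReal (t ^ (-θ) * b t) *
        ∑' j : ℕ, ENNReal.ofReal ((l ^ j)⁻¹) * e (l ^ j * t) ≤
      ENNReal.ofReal C * ∑' j : ℕ, (4⁻¹ : ℝ≥0∞) ^ j * Ψ (l ^ j * t) := by
    intro t ht
    rw [← ENNReal.tsum_mul_left, ← ENNReal.tsum_mul_left]
    refine ENNReal.tsum_le_tsum fun j => ?_
    have h1 := h t (l ^ j) ht (one_le_pow₀ (by linarith))
    have h2 : t ^ (-θ) * b t * (l ^ j)⁻¹ ≤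
        C * 4⁻¹ ^ j * ((l ^ j * t) ^ (-θ) * b (l ^ j * t)) := by
      have h3 : (l ^ j) ^ (δ + θ) * (l ^ j)⁻¹ = 4⁻¹ ^ j := by
        rw [← Real.rpow_neg_one (l ^ j), ← Real.rpow_add (hlj j), ← Real.rpow_natCast,
          ← Real.rpow_mul hl0.le, mul_comm, show δ + θ + -1 = -δ by rw [hδ]; ring,
          Real.rpow_mul hl0.le, hlδ, Real.rpow_natCast]
      calc t ^ (-θ) * b t * (l ^ j)⁻¹
          ≤ C * (l ^ j) ^ (δ + θ) * ((l ^ j * t) ^ (-θ) * b (l ^ j * t)) * (l ^ j)⁻¹ := by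
            gcongr
        _ = _ := by rw [← h3]; ring
    have hnn : 0 ≤ t ^ (-θ) * b t := (mul_pos (Real.rpow_pos_of_pos ht _) (hb.pos t ht)).le
    calc ENNReal.ofReal (t ^ (-θ) * b t) * (ENNReal.ofReal ((l ^ j)⁻¹) * e (l ^ j * t))
        = ENNReal.ofReal (t ^ (-θ) * b t * (l ^ j)⁻¹) * e (l ^ j * t) := by
          rw [← mul_assoc, ← ENNReal.ofReal_mul hnn]
      _ ≤ ENNReal.ofReal (C * 4⁻¹ ^ j * ((l ^ j * t) ^ (-θ) * b (l ^ j * t))) *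
            e (l ^ j * t) := by gcongr
      _ = _ := by
          rw [ENNReal.ofReal_mul (by positivity), ENNReal.ofReal_mul hC.le,
            ENNReal.ofReal_pow (by norm_num), ENNReal.ofReal_inv_of_pos (by norm_num)]
          simp only [hΨ, ENNReal.ofReal_ofNat]
          ring
  calc tildeNorm E _ ≤ tildeNorm E (fun t => ENNReal.ofReal C *
        ∑' j : ℕ, (4⁻¹ : ℝ≥0∞) ^ j * Ψ (l ^ j * t)) := tildeNorm_mono hE hpt
    _ = ENNReal.ofReal C * tildeNorm E (fun t => ∑' j : ℕ, (4⁻¹ : ℝ≥0∞) ^ j * Ψ (l ^ j * t)) :=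
        tildeNorm_const_mul hE ENNReal.ofReal_ne_top _
    _ ≤ ENNReal.ofReal C * (4 * tildeNorm E Ψ) := by
        gcongr
        exact tildeNorm_tsum_dilate_le hE Ψ hlj
    _ = _ := by
        rw [ENNReal.coe_mul, ENNReal.ofReal]
        simp only [ENNReal.coe_ofNat]
        ring

/-- The weight has finite norm over `[1, ∞)`: it is at most a multiple of `t ^ (-θ / 2)`, hence of a
geometrically decaying sum of indicators of the dilates of `[1, l)`. -/
theorem tildeNorm_tail_lt_top (hE : IsParameter E) (hb : IsSlowlyVarying b) {θ : ℝ} (hθ : 0 < θ) :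
    tildeNorm E ((Ici (1 : ℝ)).indicator fun t => ENNReal.ofReal (t ^ (-θ) * b t)) < ∞ := by
  set η : ℝ := θ / 2 with hη
  have hη0 : 0 < η := by linarith
  obtain ⟨C, hC, h⟩ := (hb.almostDecreasing η hη0).exists_le_mul
  set l : ℝ := 4 ^ (1 / η) with hl
  have hlη : l ^ (-η) = 4⁻¹ := by
    rw [hl, ← Real.rpow_mul (by norm_num), one_div, mul_neg, inv_mul_cancel₀ hη0.ne',
      Real.rpow_neg_one]
  have hl1 : 1 < l := Real.one_lt_rpow (by norm_num) (by positivity)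
  have hl0 : 0 < l := by linarith
  have hb1 := hb.pos 1 one_pos
  have hpt : ∀ t, 0 < t → (Ici (1 : ℝ)).indicator (fun t => ENNReal.ofReal (t ^ (-θ) * b t)) t ≤
      ENNReal.ofReal (C * b 1) *
        ∑' j : ℕ, (4⁻¹ : ℝ≥0∞) ^ j * (Ico 1 l).indicator 1 ((l ^ j)⁻¹ * t) := by
    intro t ht
    by_cases ht1 : 1 ≤ t
    swap
    · simp [ht1]
    rw [indicator_of_mem (show t ∈ Ici 1 from ht1)]
    obtain ⟨j, hj1, hj2⟩ := exists_nat_pow_near ht1 hl1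
    have hlj : 0 < l ^ j := by positivity
    have hmem : (l ^ j)⁻¹ * t ∈ Ico 1 l := by
      rw [inv_mul_eq_div, mem_Ico, le_div_iff₀ hlj, div_lt_iff₀ hlj, one_mul, ← pow_succ']
      exact ⟨hj1, hj2⟩
    have h1 : t ^ (-η) * b t ≤ C * b 1 := by simpa using h 1 t one_pos ht1
    have h2 : t ^ (-η) ≤ 4⁻¹ ^ j := by
      calc t ^ (-η) ≤ (l ^ j) ^ (-η) :=
            Real.rpow_le_rpow_of_nonpos hlj hj1 (by linarith)
        _ = 4⁻¹ ^ j := by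
          rw [← Real.rpow_natCast, ← Real.rpow_mul hl0.le, mul_comm, Real.rpow_mul hl0.le, hlη,
            Real.rpow_natCast]
    calc ENNReal.ofReal (t ^ (-θ) * b t) ≤ ENNReal.ofReal (C * b 1 * 4⁻¹ ^ j) := by
          refine ENNReal.ofReal_le_ofReal ?_
          calc t ^ (-θ) * b t = (t ^ (-η) * b t) * t ^ (-η) := by
                rw [show -θ = -η + -η by rw [hη]; ring, Real.rpow_add ht]; ring
            _ ≤ C * b 1 * 4⁻¹ ^ j := by gcongr
      _ = ENNReal.ofReal (C * b 1) *
            ((4⁻¹ : ℝ≥0∞) ^ j * (Ico 1 l).indicator 1 ((l ^ j)⁻¹ * t)) := by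
          rw [indicator_of_mem hmem, ENNReal.ofReal_mul (by positivity),
            ENNReal.ofReal_pow (by norm_num), ENNReal.ofReal_inv_of_pos (by norm_num)]
          simp
      _ ≤ _ := by
          gcongr
          exact ENNReal.le_tsum j
  refine (tildeNorm_mono hE hpt).trans_lt ?_
  rw [tildeNorm_const_mul hE ENNReal.ofReal_ne_top]
  refine ENNReal.mul_lt_top ENNReal.ofReal_lt_top ?_
  refine (tildeNorm_tsum_dilate_le hE _ fun j => by positivity).trans_lt ?_
  refine ENNReal.mul_lt_top (by simp) (tildeNorm_indicator_one_lt_top hE ?_)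
  exact (measure_mono Ico_subset_Icc_self).trans_lt (homMeasure_lt_top_of_Icc one_pos)

theorem tildeNorm_Ico_ne_zero (hE : IsParameter E) (hb : IsSlowlyVarying b) {θ : ℝ} (hθ : θ < 1) :
    tildeNorm E ((Ico (1 : ℝ) 2).indicator fun t => ENNReal.ofReal (t ^ (-θ) * b t)) ≠ 0 := by
  obtain ⟨C, hC, h⟩ := (hb.almostIncreasing 1 one_pos).exists_le_mul
  have hb1 := hb.pos 1 one_pos
  have hpt : ∀ t, 0 < t → ENNReal.ofReal (b 1 / (4 * C)) * (Ico (1 : ℝ) 2).indicator 1 t ≤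
      (Ico (1 : ℝ) 2).indicator (fun t => ENNReal.ofReal (t ^ (-θ) * b t)) t := by
    intro t ht
    by_cases ht1 : t ∈ Ico (1 : ℝ) 2
    swap
    · simp [ht1]
    rw [indicator_of_mem ht1, indicator_of_mem ht1, Pi.one_apply, mul_one]
    refine ENNReal.ofReal_le_ofReal ?_
    have h1 : b 1 ≤ C * (t * b t) := by simpa using h 1 t one_pos ht1.1
    have h2 : t⁻¹ ≤ t ^ (-θ) := by
      rw [← Real.rpow_neg_one]
      exact Real.rpow_le_rpow_of_exponent_le ht1.1 (by linarith)
    have hbt := hb.pos t ht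
    have h3 : (2 : ℝ)⁻¹ ≤ t⁻¹ := inv_anti₀ ht ht1.2.le
    calc b 1 / (4 * C) ≤ C * (t * b t) / (4 * C) := by gcongr
      _ = t * b t / 4 := by field_simp
      _ ≤ 2 * b t / 4 := by gcongr; exact ht1.2.le
      _ = 2⁻¹ * b t := by ring
      _ ≤ t ^ (-θ) * b t := by gcongr; exact h3.trans h2
  intro h0
  have := (tildeNorm_mono hE hpt).trans_eq h0
  rw [tildeNorm_const_mul hE ENNReal.ofReal_ne_top, nonpos_iff_eq_zero, mul_eq_zero] at this
  rcases this with h | h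
  · rw [ENNReal.ofReal_eq_zero] at h
    exact absurd h (not_le.2 (by positivity))
  · exact tildeNorm_indicator_one_ne_zero hE (homMeasure_Ico_pos one_pos one_lt_two) h

end Weights

/-! ### Averaging over families of sets with bounded overlap -/

section Averaging

variable {α : Type*} [MeasurableSpace α] {μ : Measure α}

/-- A measure without atoms takes all intermediate values. Via a measurable injection into `ℝ` this
reduces to the continuity of a distribution function. -/
theorem exists_measurableSet_measure_eq [MeasurableSpace.CountablySeparated α]
    [NullSingletonClass μ] {P : Set α} (hP : MeasurableSet P) (hfin : μ P ≠ ∞) {a : ℝ≥0∞}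
    (ha : a ≤ μ P) : ∃ A ⊆ P, MeasurableSet A ∧ μ A = a := by
  rcases eq_or_ne a 0 with rfl | ha0
  · exact ⟨∅, empty_subset _, MeasurableSet.empty, measure_empty⟩
  rcases eq_or_lt_of_le ha with rfl | hlt
  · exact ⟨P, Subset.rfl, hP, rfl⟩
  obtain ⟨Φ₀, hΦ₀m, hΦ₀i⟩ := MeasurableSpace.measurable_injection_nat_bool_of_countablySeparated α
  obtain ⟨e, he⟩ := exists_measurableEmbedding_real (ℕ → Bool)
  set Φ : α → ℝ := e ∘ Φ₀
  have hΦm : Measurable Φ := he.measurable.comp hΦ₀m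
  have hΦi : Function.Injective Φ := he.injective.comp hΦ₀i
  set ν : Measure ℝ := (μ.restrict P).map Φ with hν
  have hνapp : ∀ s, MeasurableSet s → ν s = μ (Φ ⁻¹' s ∩ P) := fun s hs => by
    rw [hν, Measure.map_apply hΦm hs, Measure.restrict_apply (hΦm hs)]
  have hνuniv : ν univ = μ P := by rw [hνapp _ MeasurableSet.univ]; simp
  have : IsFiniteMeasure ν := ⟨by rw [hνuniv]; exact hfin.lt_top⟩
  have : NullSingletonClass ν := ⟨fun y => by
    rw [hνapp _ (measurableSet_singleton y)]
    refine measure_mono_null inter_subset_left ?_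
    exact ((subsingleton_singleton (a := y)).preimage hΦi).measure_zero μ⟩
  have hcont : Continuous fun q : ℝ => ν.real (Iic q) := by
    have h1 : Continuous fun q : ℝ => ∫ _ in (0 : ℝ)..q, (1 : ℝ) ∂ν :=
      intervalIntegral.continuous_primitive (fun a b => intervalIntegrable_const) 0
    have h2 : (fun q : ℝ => ν.real (Iic q)) =
        fun q : ℝ => (∫ _ in (0 : ℝ)..q, (1 : ℝ) ∂ν) + ν.real (Iic 0) := by
      ext q
      rw [intervalIntegral.integral_const_of_cdf]
      simp
    rw [h2]
    exact h1.add continuous_const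
  have hat : a ≠ ∞ := (hlt.trans_le le_top).ne
  obtain ⟨q₁, hq₁⟩ : ∃ q, ν (Iic q) < a := by
    have hlim := tendsto_measure_iInter_atTop (μ := ν) (s := fun n : ℕ => Iic (-(n : ℝ)))
      (fun n => measurableSet_Iic.nullMeasurableSet)
      (fun m n hmn => Iic_subset_Iic.2 (neg_le_neg (Nat.cast_le.2 hmn))) ⟨0, measure_ne_top _ _⟩
    have hempty : ⋂ n : ℕ, Iic (-(n : ℝ)) = ∅ := by
      refine eq_empty_of_forall_notMem fun x hx => ?_
      obtain ⟨n, hn⟩ := exists_nat_gt (-x)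
      have := mem_iInter.1 hx n
      simp only [mem_Iic] at this
      linarith
    rw [hempty, measure_empty] at hlim
    obtain ⟨n, hn⟩ := (hlim.eventually (gt_mem_nhds (pos_iff_ne_zero.2 ha0))).exists
    exact ⟨_, hn⟩
  obtain ⟨q₂, hq₂⟩ : ∃ q, a < ν (Iic q) :=
    ((tendsto_measure_Iic_atTop ν).eventually (lt_mem_nhds (by rwa [hνuniv]))).exists
  obtain ⟨q, hq⟩ := mem_range_of_exists_le_of_exists_ge hcont (c := a.toReal)
    ⟨q₁, ENNReal.toReal_mono hat hq₁.le⟩ ⟨q₂, ENNReal.toReal_mono (measure_ne_top _ _) hq₂.le⟩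
  refine ⟨Φ ⁻¹' Iic q ∩ P, inter_subset_right, (hΦm measurableSet_Iic).inter hP, ?_⟩
  rw [← hνapp _ measurableSet_Iic]
  exact (ENNReal.toReal_eq_toReal_iff' (measure_ne_top _ _) hat).1 hq

/-- A set of finite measure splits into `N` measurable parts of equal measure. -/
theorem exists_equipartition [MeasurableSpace.CountablySeparated α] [NullSingletonClass μ]
    (N : ℕ) [NeZero N] {P : Set α} (hP : MeasurableSet P) (hfin : μ P ≠ ∞) :
    ∃ c : α → Fin N, Measurable c ∧ ∀ l, μ (P ∩ c ⁻¹' {l}) = μ P / N := by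
  suffices H : ∀ (N : ℕ) (P : Set α) (a : ℝ≥0∞), MeasurableSet P → μ P ≠ ∞ →
      μ P = ((N + 1 : ℕ) : ℝ≥0∞) * a →
      ∃ c : α → Fin (N + 1), Measurable c ∧ ∀ l, μ (P ∩ c ⁻¹' {l}) = a by
    obtain ⟨N, rfl⟩ := Nat.exists_eq_succ_of_ne_zero (NeZero.ne N)
    refine H N P _ hP hfin ?_
    rw [ENNReal.mul_div_cancel (by simp) (ENNReal.natCast_ne_top _)]
  clear hP hfin P
  intro N
  induction N with
  | zero =>
    intro P a _ _ ha
    refine ⟨fun _ => 0, measurable_const, fun l => ?_⟩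
    have : (fun _ : α => (0 : Fin 1)) ⁻¹' {l} = univ := by
      ext x; simp; omega
    simpa [this] using ha
  | succ N ih =>
    intro P a hP hfin ha
    have hle : a ≤ μ P := by
      rw [ha]
      refine le_mul_of_one_le_left zero_le ?_
      exact_mod_cast Nat.succ_pos _
    obtain ⟨A, hAP, hA, hμA⟩ := exists_measurableSet_measure_eq hP hfin hle
    have hafin : a ≠ ∞ := (hle.trans_lt hfin.lt_top).ne
    have hdiff : μ (P \ A) = ((N + 1 : ℕ) : ℝ≥0∞) * a := by
      rw [measure_sdiff hAP hA.nullMeasurableSet (by rwa [hμA]), ha, hμA]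
      refine ENNReal.sub_eq_of_eq_add hafin ?_
      push_cast
      ring
    obtain ⟨c, hc, hcm⟩ := ih (P \ A) a (hP.diff hA)
      ((measure_mono sdiff_subset).trans_lt hfin.lt_top).ne hdiff
    classical
    refine ⟨fun x => if x ∈ A then 0 else (c x).succ,
      Measurable.ite hA measurable_const ((measurable_of_finite Fin.succ).comp hc), fun l => ?_⟩
    induction l using Fin.cases with
    | zero =>
      rw [← hμA]
      congr 1
      ext x
      by_cases hx : x ∈ A
      · simp [hx, hAP hx]
      · simp [hx]
    | succ l =>
      rw [← hcm l]
      congr 1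
      ext x
      by_cases hx : x ∈ A
      · simp [hx, (Fin.succ_ne_zero l).symm]
      · simp [hx]

theorem lintegral_eq_lintegral_distribution [SFinite μ] {f : α → ℝ≥0∞} (hf : Measurable f) :
    ∫⁻ x, f x ∂μ = ∫⁻ t in Ioi (0 : ℝ), μ {x | ENNReal.ofReal t < f x} := by
  have hm : MeasurableSet {z : α × ℝ | ENNReal.ofReal z.2 < f z.1} :=
    measurableSet_lt (ENNReal.measurable_ofReal.comp measurable_snd) (hf.comp measurable_fst)
  calc ∫⁻ x, f x ∂μ
      = ∫⁻ x, (volume.restrict (Ioi (0 : ℝ))) {t | ENNReal.ofReal t < f x} ∂μ := by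
        simp_rw [volume_Ioi_lt_ofReal]
    _ = (μ.prod (volume.restrict (Ioi (0 : ℝ)))) {z : α × ℝ | ENNReal.ofReal z.2 < f z.1} := by
        rw [Measure.prod_apply hm]; rfl
    _ = _ := by
        rw [Measure.prod_apply_symm hm]; rfl

theorem lintegral_rearrangement [SFinite μ] {f : α → ℝ≥0∞} (hf : Measurable f) :
    ∫⁻ s in Ioi (0 : ℝ), rearrangement μ f s = ∫⁻ x, f x ∂μ := by
  rw [lintegral_eq_lintegral_distribution hf,
    lintegral_eq_lintegral_distribution (measurable_rearrangement f)]
  simp_rw [volume_lt_rearrangement]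

theorem lintegral_Ioc_le_sum {r : ℝ → ℝ≥0∞} (hr : Antitone r) {h : ℝ} (hh : 0 ≤ h) (a : ℝ)
    (n : ℕ) : ∫⁻ s in Ioc a (a + n * h), r s ≤
      ENNReal.ofReal h * ∑ j ∈ Finset.range n, r (a + j * h) := by
  induction n with
  | zero => simp
  | succ n ih =>
    have h1 : Ioc a (a + (n + 1 : ℕ) * h) =
        Ioc a (a + n * h) ∪ Ioc (a + n * h) (a + (n + 1 : ℕ) * h) := by
      rw [Ioc_union_Ioc_eq_Ioc]
      · have : 0 ≤ (n : ℝ) * h := by positivity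
        linarith
      · push_cast; linarith
    rw [h1, Finset.sum_range_succ, mul_add]
    refine (lintegral_union_le _ _ _).trans (add_le_add ih ?_)
    calc ∫⁻ s in Ioc (a + n * h) (a + (n + 1 : ℕ) * h), r s
        ≤ ∫⁻ _ in Ioc (a + n * h) (a + (n + 1 : ℕ) * h), r (a + n * h) :=
          setLIntegral_mono measurable_const fun s hs => hr hs.1.le
      _ = _ := by
          rw [setLIntegral_const, Real.volume_Ioc, mul_comm]
          congr 2
          push_cast; ring

/-- The `n` sample points `j m / n`, `1 ≤ j ≤ n`, of a rearrangement over a set of measure `m` are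
no more frequent above a level than the function itself. -/
theorem card_sample_mul_le {Q : Set α} (hQ : μ Q ≠ ∞) (f : α → ℝ≥0∞) (n : ℕ) (t : ℝ≥0∞) :
    (((Finset.range (n + 1)).filter fun j : ℕ =>
      t < rearrangement (μ.restrict Q) f ((j + 1) * ((μ Q).toReal / (n + 1)))).card : ℝ≥0∞) *
        (μ Q / (n + 1)) ≤ (μ.restrict Q) {x | t < f x} := by
  set S := (Finset.range (n + 1)).filter fun j : ℕ =>
      t < rearrangement (μ.restrict Q) f ((j + 1) * ((μ Q).toReal / (n + 1))) with hS
  rcases S.eq_empty_or_nonempty with h | h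
  · simp [h]
  · set j := S.max' h with hj
    have hjS : j ∈ S := S.max'_mem h
    have hcard : S.card ≤ j + 1 := by
      rw [← Finset.card_range (j + 1)]
      refine Finset.card_le_card fun i hi => ?_
      rw [Finset.mem_range, Nat.lt_succ_iff]
      exact S.le_max' i hi
    have hlt := (Finset.mem_filter.1 hjS).2
    rw [lt_rearrangement_iff] at hlt
    refine le_trans ?_ hlt.le
    have hn : (0 : ℝ) < n + 1 := by positivity
    rw [ENNReal.ofReal_mul (by positivity), ENNReal.ofReal_div_of_pos hn, ENNReal.ofReal_toReal hQ]
    have h1 : ENNReal.ofReal ((n : ℝ) + 1) = n + 1 := by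
      exact_mod_cast ENNReal.ofReal_natCast (n + 1)
    have h2 : ENNReal.ofReal ((j : ℝ) + 1) = ((j + 1 : ℕ) : ℝ≥0∞) := by
      exact_mod_cast ENNReal.ofReal_natCast (j + 1)
    rw [h1, h2]
    gcongr

theorem tsum_restrict_le_of_overlap {κ : Type*} [Countable κ] {Q : κ → Set α}
    (hQ : ∀ i, MeasurableSet (Q i)) {M : ℝ≥0∞}
    (hM : ∀ x, ∑' i, (Q i).indicator (1 : α → ℝ≥0∞) x ≤ M) {S : Set α} (hS : MeasurableSet S) :
    ∑' i, (μ.restrict (Q i)) S ≤ M * μ S := by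
  have h1 : ∀ i, (μ.restrict (Q i)) S = ∫⁻ x in S, (Q i).indicator 1 x ∂μ := fun i => by
    rw [lintegral_indicator_one (hQ i), Measure.restrict_apply hS, Measure.restrict_apply (hQ i),
      inter_comm]
  simp_rw [h1]
  rw [← lintegral_tsum fun i => (measurable_one.indicator (hQ i)).aemeasurable]
  calc ∫⁻ x in S, ∑' i, (Q i).indicator 1 x ∂μ ≤ ∫⁻ _ in S, M ∂μ := lintegral_mono fun x => hM x
    _ = M * μ S := by rw [setLIntegral_const]

/-- The discretised averaging estimate. The cells `{ι = i}` are cut into `M (n + 1)` equal parts,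
on which `n + 1` samples of the rearrangement of `f` over `Q i`, and zeros, are placed in all
cyclic orders. Each arrangement has at most the distribution of `f`, and their mean is the function
on the left. -/
theorem IsRINorm.sample_mean_le {κ : Type*} [Countable κ] [MeasurableSpace κ]
    [MeasurableSingletonClass κ] [MeasurableSpace.CountablySeparated α] [NullSingletonClass μ]
    {X : (α → ℝ≥0∞) → ℝ≥0∞} (hX : IsRINorm μ X) {ι : α → κ} (hι : Measurable ι) {Q : κ → Set α}
    (hQ : ∀ i, MeasurableSet (Q i)) (hQfin : ∀ i, μ (Q i) ≠ ∞)
    (hPQ : ∀ i, μ (ι ⁻¹' {i}) ≤ μ (Q i)) {M : ℕ} (hM0 : M ≠ 0)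
    (hM : ∀ x, ∑' i, (Q i).indicator (1 : α → ℝ≥0∞) x ≤ M) {f : α → ℝ≥0∞} (hf : Measurable f)
    (n : ℕ) :
    X (fun x => ((M * (n + 1) : ℕ) : ℝ≥0∞)⁻¹ * ∑ j ∈ Finset.range (n + 1),
      rearrangement (μ.restrict (Q (ι x))) f ((j + 1) * ((μ (Q (ι x))).toReal / (n + 1)))) ≤
      X f := by
  set N : ℕ := M * (n + 1) with hN
  have hN0 : N ≠ 0 := by positivity
  have hnN : n + 1 ≤ N := Nat.le_mul_of_pos_left _ (Nat.pos_of_ne_zero hM0)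
  have : NeZero N := ⟨hN0⟩
  have hP : ∀ i, MeasurableSet (ι ⁻¹' {i}) := fun i => hι (measurableSet_singleton i)
  have hPfin : ∀ i, μ (ι ⁻¹' {i}) ≠ ∞ := fun i => ((hPQ i).trans_lt (hQfin i).lt_top).ne
  choose c hc hcμ using fun i => exists_equipartition N (hP i) (hPfin i)
  set w : κ → ℕ → ℝ≥0∞ := fun i j => rearrangement (μ.restrict (Q i)) f
    ((j + 1) * ((μ (Q i)).toReal / (n + 1))) with hw
  set v : κ → Fin N → ℝ≥0∞ := fun i j => if (j : ℕ) < n + 1 then w i j else 0 with hv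
  set h : Fin N → α → ℝ≥0∞ := fun k x => v (ι x) (c (ι x) x + k) with hh
  have hcm : Measurable fun x => c (ι x) x :=
    measurable_from_prod_countable_right (f := fun z : κ × α => c z.1 z.2) (fun i => hc i)
      |>.comp (hι.prodMk measurable_id)
  have hhm : ∀ k, Measurable (h k) := fun k =>
    (measurable_of_countable fun z : κ × Fin N => v z.1 (z.2 + k)).comp (hι.prodMk hcm)
  -- the sum over the cyclic shifts does not depend on the part
  have hsumk : ∀ x, ∑ k, h k x = ∑ j ∈ Finset.range (n + 1), w (ι x) j := by
    intro x
    rw [show ∑ k, h k x = ∑ j, v (ι x) j from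
      Equiv.sum_comp (Equiv.addLeft (c (ι x) x)) (fun j => v (ι x) j)]
    rw [Fin.sum_univ_eq_sum_range (fun j => if j < n + 1 then w (ι x) j else 0) N]
    rw [← Finset.sum_filter]
    congr 1
    ext j
    simp only [Finset.mem_filter, Finset.mem_range]
    omega
  have hdist : ∀ k t, μ {x | t < h k x} ≤ μ {x | t < f x} := by
    intro k t
    have hM' : (M : ℝ≥0∞) ≠ 0 := by exact_mod_cast hM0
    have hsub : {x | t < h k x} ⊆ ⋃ i, ⋃ l ∈ Finset.univ.filter (fun l : Fin N => t < v i (l + k)),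
        (ι ⁻¹' {i} ∩ c i ⁻¹' {l}) := by
      intro x hx
      simp only [mem_iUnion]
      refine ⟨ι x, c (ι x) x, ?_, rfl, rfl⟩
      simpa using hx
    have hcard : ∀ i, (Finset.univ.filter (fun l : Fin N => t < v i (l + k))).card =
        ((Finset.range (n + 1)).filter fun j : ℕ => t < w i j).card := by
      intro i
      have e1 : (Finset.univ.filter (fun l : Fin N => t < v i (l + k))).card =
          (Finset.univ.filter (fun l : Fin N => t < v i l)).card := by
        rw [Finset.card_filter, Finset.card_filter]
        exact Equiv.sum_comp (Equiv.addRight k) (fun l => if t < v i l then 1 else 0)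
      rw [e1, Finset.card_filter, Fin.sum_univ_eq_sum_range
        (fun j => if t < (if j < n + 1 then w i j else 0) then 1 else 0) N, ← Finset.card_filter]
      congr 1
      ext j
      simp only [Finset.mem_filter, Finset.mem_range]
      constructor
      · rintro ⟨-, hj⟩
        by_cases hjn : j < n + 1
        · exact ⟨hjn, by simpa [hjn] using hj⟩
        · simp [hjn] at hj
      · rintro ⟨hjn, hj⟩
        exact ⟨by omega, by simpa [hjn] using hj⟩
    have hterm : ∀ i, μ (⋃ l ∈ Finset.univ.filter (fun l : Fin N => t < v i (l + k)),
        (ι ⁻¹' {i} ∩ c i ⁻¹' {l})) ≤ (M : ℝ≥0∞)⁻¹ * (μ.restrict (Q i)) {x | t < f x} := by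
      intro i
      refine (measure_biUnion_finset_le _ _).trans ?_
      rw [Finset.sum_congr rfl fun l _ => hcμ i l, Finset.sum_const, nsmul_eq_mul, hcard]
      calc _ ≤ (((Finset.range (n + 1)).filter fun j : ℕ => t < w i j).card : ℝ≥0∞) *
            (μ (Q i) / N) := by exact mul_le_mul_right (ENNReal.div_le_div_right (hPQ i) _) _
        _ = (M : ℝ≥0∞)⁻¹ * ((((Finset.range (n + 1)).filter fun j : ℕ => t < w i j).card : ℝ≥0∞) *
            (μ (Q i) / (n + 1))) := by
          rw [hN, Nat.cast_mul, div_eq_mul_inv, div_eq_mul_inv,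
            ENNReal.mul_inv (Or.inl hM') (Or.inl (ENNReal.natCast_ne_top _))]
          push_cast
          ring
        _ ≤ _ := by gcongr; exact card_sample_mul_le (hQfin i) f n t
    calc μ {x | t < h k x} ≤ _ := measure_mono hsub
      _ ≤ ∑' i, (M : ℝ≥0∞)⁻¹ * (μ.restrict (Q i)) {x | t < f x} :=
          (measure_iUnion_le _).trans (ENNReal.tsum_le_tsum hterm)
      _ ≤ (M : ℝ≥0∞)⁻¹ * (M * μ {x | t < f x}) := by
          rw [ENNReal.tsum_mul_left]
          gcongr
          exact tsum_restrict_le_of_overlap hQ hM (measurableSet_lt measurable_const hf)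
      _ = μ {x | t < f x} := by
          rw [← mul_assoc, ENNReal.inv_mul_cancel hM' (ENNReal.natCast_ne_top _), one_mul]
  have hN0' : (N : ℝ≥0∞) ≠ 0 := by exact_mod_cast hN0
  calc X _ = X (fun x => (N : ℝ≥0∞)⁻¹ * ∑ k, h k x) := by simp_rw [hsumk]; rfl
    _ = (N : ℝ≥0∞)⁻¹ * X (fun x => ∑ k, h k x) :=
        hX.const_mul (ENNReal.inv_ne_top.2 hN0') (Finset.measurable_fun_sum _ fun k _ => hhm k)
    _ ≤ (N : ℝ≥0∞)⁻¹ * ∑ _k : Fin N, X f := by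
        gcongr
        refine (hX.sum_le _ hhm).trans (Finset.sum_le_sum fun k _ => ?_)
        exact hX.le_of_distribution (hhm k) hf (hdist k)
    _ = X f := by
        rw [Finset.sum_const, Finset.card_univ, Fintype.card_fin, nsmul_eq_mul, ← mul_assoc,
          ENNReal.inv_mul_cancel hN0' (ENNReal.natCast_ne_top _), one_mul]

/-- Averaging operators over families of sets with overlap at most `M` are bounded on r.i. spaces,
with norm at most `M`. -/
theorem IsRINorm.laverage_le {κ : Type*} [Countable κ] [MeasurableSpace κ]
    [MeasurableSingletonClass κ] [MeasurableSpace.CountablySeparated α] [NullSingletonClass μ]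
    {X : (α → ℝ≥0∞) → ℝ≥0∞} (hX : IsRINorm μ X) {ι : α → κ} (hι : Measurable ι) {Q : κ → Set α}
    (hQ : ∀ i, MeasurableSet (Q i)) (hQfin : ∀ i, μ (Q i) ≠ ∞)
    (hPQ : ∀ i, μ (ι ⁻¹' {i}) ≤ μ (Q i)) {M : ℕ} (hM0 : M ≠ 0)
    (hM : ∀ x, ∑' i, (Q i).indicator (1 : α → ℝ≥0∞) x ≤ M) {f : α → ℝ≥0∞} (hf : Measurable f) :
    X (fun x => ⨍⁻ y in Q (ι x), f y ∂μ) ≤ M * X f := by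
  -- Riemann sums with right endpoints dominate the integral of the rearrangement off the first cell
  set F : ℕ → κ → ℝ≥0∞ := fun n i => (μ (Q i))⁻¹ *
    ∫⁻ s in Ioi ((μ (Q i)).toReal / (n + 1)), rearrangement (μ.restrict (Q i)) f s with hF
  have hlim : ∀ i, (⨍⁻ y in Q i, f y ∂μ) = ⨆ n, F n i := by
    intro i
    have : IsFiniteMeasure (μ.restrict (Q i)) := ⟨by simpa using (hQfin i).lt_top⟩
    rw [setLAverage_eq, ENNReal.div_eq_inv_mul, ← lintegral_rearrangement hf, ← ENNReal.mul_iSup]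
    congr 1
    have hU : Ioi (0 : ℝ) = ⋃ n : ℕ, Ioi ((μ (Q i)).toReal / (n + 1)) := by
      ext s
      simp only [mem_iUnion, mem_Ioi]
      constructor
      · intro hs
        obtain ⟨n, hn⟩ := exists_nat_gt ((μ (Q i)).toReal / s)
        refine ⟨n, ?_⟩
        rw [div_lt_iff₀ hs] at hn
        rw [div_lt_iff₀ (by positivity)]
        linarith
      · rintro ⟨n, hn⟩
        exact lt_of_le_of_lt (by positivity) hn
    rw [hU, setLIntegral_iUnion_of_directed]
    refine Monotone.directed_le fun m n hmn => Ioi_subset_Ioi ?_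
    gcongr
  have hmono : Monotone fun n x => F n (ι x) := by
    intro m n hmn x
    refine mul_le_mul_right (lintegral_mono_set (Ioi_subset_Ioi ?_)) _
    gcongr
  have hbound : ∀ n, X (fun x => F n (ι x)) ≤ M * X f := by
    intro n
    have hm : ∀ G : κ → ℝ≥0∞, Measurable fun x => G (ι x) := fun G =>
      (measurable_of_countable G).comp hι
    set G : κ → ℝ≥0∞ := fun i => ((M * (n + 1) : ℕ) : ℝ≥0∞)⁻¹ * ∑ j ∈ Finset.range (n + 1),
      rearrangement (μ.restrict (Q i)) f ((j + 1) * ((μ (Q i)).toReal / (n + 1))) with hG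
    refine le_trans ?_ (mul_le_mul_right (hX.sample_mean_le hι hQ hQfin hPQ hM0 hM hf n) _)
    rw [← hX.const_mul (ENNReal.natCast_ne_top M) (hm G)]
    refine hX.mono' (hm (F n)) ((hm G).const_mul _) fun x => ?_
    generalize ι x = i
    set r := rearrangement (μ.restrict (Q i)) f with hr
    set d : ℝ := (μ (Q i)).toReal / (n + 1) with hd
    have hd0 : 0 ≤ d := by positivity
    have hdm : (n + 1 : ℕ) * d = (μ (Q i)).toReal := by
      rw [hd]; push_cast; field_simp
    have hr0 : ∀ s, (μ (Q i)).toReal ≤ s → r s = 0 := by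
      intro s hs
      rw [← nonpos_iff_eq_zero, hr, rearrangement_le_iff]
      refine (measure_mono (subset_univ _)).trans ?_
      rw [Measure.restrict_apply_univ]
      exact ENNReal.le_ofReal_iff_toReal_le (hQfin i) (ENNReal.toReal_nonneg.trans hs) |>.2 hs
    have h1 : ∫⁻ s in Ioi d, r s ≤ ∫⁻ s in Ioc d (d + (n + 1 : ℕ) * d), r s := by
      have hsplit : Ioi d = Ioc d (d + (n + 1 : ℕ) * d) ∪ Ioi (d + (n + 1 : ℕ) * d) := by
        rw [Ioc_union_Ioi_eq_Ioi]
        exact le_add_of_nonneg_right (by positivity)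
      have h0 : ∫⁻ s in Ioi (d + (n + 1 : ℕ) * d), r s = 0 := by
        rw [setLIntegral_congr_fun measurableSet_Ioi (g := fun _ => 0), lintegral_zero]
        intro s hs
        refine hr0 s ?_
        have := mem_Ioi.1 hs
        rw [hdm] at this
        linarith
      rw [hsplit]
      exact (lintegral_union_le _ _ _).trans_eq (by rw [h0, add_zero])
    have h2 := h1.trans (lintegral_Ioc_le_sum (antitone_rearrangement f) hd0 d (n + 1))
    have h3 : ENNReal.ofReal d = μ (Q i) * ((n + 1 : ℕ) : ℝ≥0∞)⁻¹ := by
      rw [hd, ENNReal.ofReal_div_of_pos (by positivity), ENNReal.ofReal_toReal (hQfin i),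
        ENNReal.div_eq_inv_mul, mul_comm]
      congr 2
      exact_mod_cast ENNReal.ofReal_natCast (n + 1)
    have h4 : (M : ℝ≥0∞) * ((M * (n + 1) : ℕ) : ℝ≥0∞)⁻¹ = ((n + 1 : ℕ) : ℝ≥0∞)⁻¹ := by
      have hM' : (M : ℝ≥0∞) ≠ 0 := by exact_mod_cast hM0
      rw [Nat.cast_mul, ENNReal.mul_inv (Or.inl hM') (Or.inl (ENNReal.natCast_ne_top _)),
        ← mul_assoc, ENNReal.mul_inv_cancel hM' (ENNReal.natCast_ne_top _), one_mul]
    have h5 : ∀ j : ℕ, d + j * d = (j + 1) * d := fun j => by ring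
    calc F n i ≤ (μ (Q i))⁻¹ * (μ (Q i) * ((n + 1 : ℕ) : ℝ≥0∞)⁻¹ *
          ∑ j ∈ Finset.range (n + 1), r (d + j * d)) := by
          rw [← h3]; exact mul_le_mul_right h2 _
      _ = ((μ (Q i))⁻¹ * μ (Q i)) * (((n + 1 : ℕ) : ℝ≥0∞)⁻¹ *
          ∑ j ∈ Finset.range (n + 1), r (d + j * d)) := by ring
      _ ≤ 1 * (((n + 1 : ℕ) : ℝ≥0∞)⁻¹ * ∑ j ∈ Finset.range (n + 1), r (d + j * d)) := by
          gcongr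
          exact ENNReal.inv_mul_le_one _
      _ = M * G i := by
          rw [one_mul, hG]
          simp_rw [h5]
          rw [← mul_assoc, h4]
  simp_rw [hlim]
  rw [hX.fatou (fun n x => F n (ι x)) (fun n => (measurable_of_countable (F n)).comp hι) hmono]
  exact iSup_le hbound

end Averaging

/-! ### Ball averages in doubling spaces -/

section Doubling

variable {Ω : Type*} [MetricSpace Ω] [MeasurableSpace Ω] {μ : Measure Ω}

theorem IsRDSpace.exists_doubling (hΩ : IsRDSpace μ) {l : ℝ} (hl : 1 ≤ l) :
    ∃ C : ℕ, C ≠ 0 ∧ ∀ (x : Ω) (r : ℝ), 0 < r → μ (ball x (l * r)) ≤ C * μ (ball x r) := by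
  obtain ⟨C₁, C₂, k, n, -, -, -, -, -, h⟩ := hΩ.growth
  obtain ⟨C, hC⟩ := exists_nat_gt (C₂ * l ^ n)
  refine ⟨C + 1, by omega, fun x r hr => ?_⟩
  have h1 := (h x r l hr hl).2
  have hfin := (hΩ.ball_lt_top x r hr).ne
  have hfin' := (hΩ.ball_lt_top x (l * r) (by positivity)).ne
  rw [← ENNReal.ofReal_toReal hfin', ← ENNReal.ofReal_toReal hfin,
    ← ENNReal.ofReal_natCast, ← ENNReal.ofReal_mul (by positivity)]
  refine ENNReal.ofReal_le_ofReal (h1.trans ?_)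
  refine mul_le_mul_of_nonneg_right ?_ ENNReal.toReal_nonneg
  push_cast
  linarith

theorem exists_separated_net (Ω : Type*) [MetricSpace Ω] {r : ℝ} (hr : 0 < r) :
    ∃ s : Set Ω, s.Pairwise (fun x y => r ≤ dist x y) ∧ ∀ x, ∃ y ∈ s, dist x y < r := by
  obtain ⟨s, hs⟩ := zorn_subset {s : Set Ω | s.Pairwise fun x y => r ≤ dist x y} (by
    intro c hc hchain
    refine ⟨⋃₀ c, ?_, fun s hs => subset_sUnion_of_mem hs⟩
    exact (pairwise_sUnion hchain.directedOn).2 fun a ha => hc ha)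
  refine ⟨s, hs.prop, fun x => ?_⟩
  by_contra! hcon
  have hx : x ∉ s := fun hx => absurd (hcon x hx) (by simpa using hr)
  refine hx (hs.le_of_ge (y := insert x s) ?_ (subset_insert x s) (mem_insert x s))
  exact hs.prop.insert fun y hy _ => ⟨hcon y hy, by rw [dist_comm]; exact hcon y hy⟩

/-- Separated sets are countable, as they index disjoint balls of positive measure. -/
theorem IsRDSpace.countable_of_separated [BorelSpace Ω] (hΩ : IsRDSpace μ) {r : ℝ} (hr : 0 < r)
    {s : Set Ω} (hs : s.Pairwise fun x y => r ≤ dist x y) : s.Countable := by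
  rcases isEmpty_or_nonempty Ω with _ | ⟨⟨x₀⟩⟩
  · exact s.to_countable
  have : SigmaFinite μ := ⟨⟨{
    set := fun n => ball x₀ (n + 1)
    set_mem := fun _ => trivial
    finite := fun n => hΩ.ball_lt_top _ _ (by positivity)
    spanning := by
      refine eq_univ_of_forall fun x => mem_iUnion.2 ?_
      obtain ⟨n, hn⟩ := exists_nat_gt (dist x x₀)
      exact ⟨n, by rw [mem_ball]; linarith⟩ }⟩⟩
  have := Measure.countable_meas_pos_of_disjoint_iUnion (μ := μ)
    (As := fun y : s => ball (y : Ω) (r / 2)) (fun _ => measurableSet_ball) (by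
      intro y z hyz
      refine ball_disjoint_ball ?_
      have := hs y.2 z.2 (fun h => hyz (Subtype.ext h))
      linarith)
  have huniv : {y : s | 0 < μ (ball (y : Ω) (r / 2))} = univ :=
    eq_univ_of_forall fun y => hΩ.ball_pos _ _ (by linarith)
  rw [huniv] at this
  exact Set.countable_coe_iff.1 (Set.countable_univ_iff.1 this)

theorem IsRDSpace.secondCountableTopology [BorelSpace Ω] (hΩ : IsRDSpace μ) :
    SecondCountableTopology Ω := by
  refine Metric.secondCountable_of_almost_dense_set fun ε hε => ?_
  obtain ⟨s, hs, hcov⟩ := exists_separated_net Ω hε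
  refine ⟨s, hΩ.countable_of_separated hε hs, fun x => ?_⟩
  obtain ⟨y, hy, hxy⟩ := hcov x
  exact ⟨y, hy, hxy.le⟩

theorem IsRDSpace.isLocallyFiniteMeasure (hΩ : IsRDSpace μ) : IsLocallyFiniteMeasure μ :=
  ⟨fun x => ⟨ball x 1, ball_mem_nhds x one_pos, hΩ.ball_lt_top x 1 one_pos⟩⟩

theorem setLAverage_le_of_subset {α : Type*} [MeasurableSpace α] {μ : Measure α} {A B : Set α}
    (hAB : A ⊆ B) {C : ℝ≥0∞} (hC0 : C ≠ 0) (hC : C ≠ ∞)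
    (hBA : μ B ≤ C * μ A) (f : α → ℝ≥0∞) : ⨍⁻ y in A, f y ∂μ ≤ C * ⨍⁻ y in B, f y ∂μ := by
  rw [setLAverage_eq, setLAverage_eq, ENNReal.div_eq_inv_mul, ENNReal.div_eq_inv_mul, ← mul_assoc]
  refine mul_le_mul' ?_ (lintegral_mono_set hAB)
  calc (μ A)⁻¹ = C * (C * μ A)⁻¹ := by
        rw [ENNReal.mul_inv (Or.inl hC0) (Or.inl hC), ← mul_assoc, ENNReal.mul_inv_cancel hC0 hC,
          one_mul]
    _ ≤ C * (μ B)⁻¹ := by gcongr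

/-- Balls about the points of an `r`-separated set overlap boundedly, with a bound that does not
depend on `r`: the concentric balls of radius `r / 2` are disjoint and of comparable measure. -/
theorem IsRDSpace.exists_overlap_le [BorelSpace Ω] (hΩ : IsRDSpace μ) :
    ∃ M : ℕ, M ≠ 0 ∧ ∀ (r : ℝ) (s : Set Ω), 0 < r → s.Pairwise (fun x y => r ≤ dist x y) →
      ∀ x, ∑' y : s, (ball (y : Ω) (2 * r)).indicator (1 : Ω → ℝ≥0∞) x ≤ M := by
  obtain ⟨M, hM0, hM⟩ := hΩ.exists_doubling (l := 10) (by norm_num)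
  refine ⟨M, hM0, fun r s hr hs x => ?_⟩
  have : Countable s := (hΩ.countable_of_separated hr hs).to_subtype
  have hpos := hΩ.ball_pos x (3 * r) (by positivity)
  have hfin := hΩ.ball_lt_top x (3 * r) (by positivity)
  set B : s → Set Ω := fun y => {z ∈ ball (y : Ω) (r / 2) | x ∈ ball (y : Ω) (2 * r)} with hB
  have hBm : ∀ y, MeasurableSet (B y) := fun y => measurableSet_ball.inter (.const _)
  have hBd : Pairwise (Function.onFun Disjoint B) := by
    intro y z hyz
    have := hs y.2 z.2 (fun h => hyz (Subtype.ext h))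
    exact (ball_disjoint_ball (by linarith)).mono (sep_subset _ _) (sep_subset _ _)
  have hBsub : ⋃ y, B y ⊆ ball x (3 * r) := by
    refine iUnion_subset fun y z hz => ?_
    have h1 := mem_ball.1 hz.1
    have h2 := mem_ball'.1 hz.2
    rw [mem_ball]
    linarith [dist_triangle z y x]
  have hterm : ∀ y : s, (ball (y : Ω) (2 * r)).indicator (1 : Ω → ℝ≥0∞) x * μ (ball x (3 * r)) ≤
      M * μ (B y) := by
    intro y
    by_cases hx : x ∈ ball (y : Ω) (2 * r)
    · have hBy : B y = ball (y : Ω) (r / 2) := by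
        ext z; simp only [hB, mem_ofPred_eq, hx, and_true]
      rw [indicator_of_mem hx, Pi.one_apply, one_mul, hBy]
      refine le_trans (measure_mono ?_) (hM y (r / 2) (by linarith))
      refine ball_subset_ball' ?_
      have := mem_ball.1 hx
      linarith
    · simp [hx]
  have hsum : (∑' y : s, (ball (y : Ω) (2 * r)).indicator (1 : Ω → ℝ≥0∞) x) * μ (ball x (3 * r)) ≤
      M * μ (ball x (3 * r)) := by
    rw [← ENNReal.tsum_mul_right]
    refine (ENNReal.tsum_le_tsum hterm).trans ?_
    rw [ENNReal.tsum_mul_left, ← measure_iUnion hBd hBm]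
    gcongr
  exact (ENNReal.mul_le_mul_iff_left hpos.ne' hfin.ne).1 hsum

theorem measurable_setLAverage_ball [OpensMeasurableSpace Ω] [SecondCountableTopology Ω] [SFinite μ]
    {F : Ω × Ω → ℝ≥0∞} (hF : Measurable F) (r : ℝ) :
    Measurable fun x => ⨍⁻ y in ball x r, F (x, y) ∂μ := by
  have hS : MeasurableSet {z : Ω × Ω | dist z.2 z.1 < r} :=
    measurableSet_lt (measurable_snd.dist measurable_fst) measurable_const
  simp_rw [setLAverage_eq]
  refine Measurable.div ?_ (measurable_measure_prodMk_left hS)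
  simp_rw [← lintegral_indicator measurableSet_ball]
  exact (hF.indicator hS).lintegral_prod_right'

/-- On an r.i. space over a doubling space, averages over balls of a fixed radius are bounded
uniformly in the radius. -/
theorem IsRDSpace.exists_laverage_ball_le [BorelSpace Ω] [NullSingletonClass μ]
    (hΩ : IsRDSpace μ) {X : (Ω → ℝ≥0∞) → ℝ≥0∞} (hX : IsRINorm μ X) :
    ∃ C : ℝ≥0, ∀ (r : ℝ) (f : Ω → ℝ≥0∞), 0 < r → Measurable f →
      X (fun x => ⨍⁻ y in ball x r, f y ∂μ) ≤ C * X f := by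
  have := hΩ.secondCountableTopology
  have := hΩ.isLocallyFiniteMeasure
  obtain ⟨M, hM0, hM⟩ := hΩ.exists_overlap_le
  obtain ⟨D, hD0, hD⟩ := hΩ.exists_doubling (l := 3) (by norm_num)
  refine ⟨D * M, fun r f hr hf => ?_⟩
  rcases isEmpty_or_nonempty Ω with _ | hne
  · refine le_of_eq_of_le ?_ zero_le
    rw [hX.eq_zero_iff _ (measurable_of_countable _)]
    exact Filter.Eventually.of_forall fun x => isEmptyElim x
  obtain ⟨s, hs, hcov⟩ := exists_separated_net Ω hr
  have : Countable s := (hΩ.countable_of_separated hr hs).to_subtype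
  have : Nonempty s := by
    obtain ⟨y, hy, -⟩ := hcov hne.some
    exact ⟨⟨y, hy⟩⟩
  obtain ⟨e, he⟩ := exists_surjective_nat s
  have hex : ∀ x : Ω, ∃ n, dist x (e n) < r := by
    intro x
    obtain ⟨y, hy, hxy⟩ := hcov x
    obtain ⟨n, hn⟩ := he ⟨y, hy⟩
    exact ⟨n, by rw [hn]; exact hxy⟩
  classical
  set ι : Ω → s := fun x => e (Nat.find (hex x)) with hι
  have hιm : Measurable ι :=
    (measurable_of_countable e).comp (measurable_find hex fun n => measurableSet_ball)
  have hιd : ∀ x : Ω, dist x (ι x) < r := fun x => Nat.find_spec (hex x)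
  have key := hX.laverage_le hιm (Q := fun y => ball (y : Ω) (2 * r)) (fun _ => measurableSet_ball)
    (fun y => (hΩ.ball_lt_top _ _ (by positivity)).ne)
    (fun y => measure_mono fun x hx => by
      have h1 := hιd x
      rw [show ι x = y from hx] at h1
      rw [mem_ball]; linarith) hM0 (hM r s hr hs) hf
  have hm1 : Measurable fun x => ⨍⁻ y in ball x r, f y ∂μ :=
    measurable_setLAverage_ball (hf.comp measurable_snd) r
  have hm2 : Measurable fun x => ⨍⁻ y in ball (ι x : Ω) (2 * r), f y ∂μ :=
    (measurable_of_countable fun z : s => ⨍⁻ y in ball (z : Ω) (2 * r), f y ∂μ).comp hιm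
  calc X (fun x => ⨍⁻ y in ball x r, f y ∂μ)
      ≤ X (fun x => (D : ℝ≥0∞) * ⨍⁻ y in ball (ι x : Ω) (2 * r), f y ∂μ) := by
        refine hX.mono' hm1 (hm2.const_mul _) fun x => ?_
        have h1 := hιd x
        refine setLAverage_le_of_subset (ball_subset_ball' (by linarith)) (by exact_mod_cast hD0)
          (ENNReal.natCast_ne_top _) (le_trans (measure_mono ?_) (hD x r hr)) f
        refine ball_subset_ball' ?_
        rw [dist_comm]; linarith
    _ = D * X (fun x => ⨍⁻ y in ball (ι x : Ω) (2 * r), f y ∂μ) :=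
        hX.const_mul (ENNReal.natCast_ne_top _) hm2
    _ ≤ D * (M * X f) := by gcongr
    _ = _ := by push_cast; ring

end Doubling

/-! ### Moduli of continuity and smoothing -/

section Bump

variable {Ω : Type*} [MetricSpace Ω]

/-- The cone of height `1` over the ball `B(x, t)`. -/
def bump (t : ℝ) (x z : Ω) : ℝ := max 0 (1 - dist x z / t)

theorem bump_nonneg (t : ℝ) (x z : Ω) : 0 ≤ bump t x z := le_max_left _ _

theorem bump_le_one {t : ℝ} (ht : 0 < t) (x z : Ω) : bump t x z ≤ 1 := by
  refine max_le zero_le_one ?_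
  have : 0 ≤ dist x z / t := by positivity
  linarith

theorem bump_eq_zero {t : ℝ} (ht : 0 < t) {x z : Ω} (h : z ∉ ball x t) : bump t x z = 0 := by
  refine max_eq_left ?_
  rw [mem_ball', not_lt] at h
  have : 1 ≤ dist x z / t := by rwa [le_div_iff₀ ht, one_mul]
  linarith

theorem half_le_bump {t : ℝ} (ht : 0 < t) {x z : Ω} (h : z ∈ ball x (t / 2)) :
    1 / 2 ≤ bump t x z := by
  refine le_trans ?_ (le_max_right _ _)
  rw [mem_ball'] at h
  have : dist x z / t ≤ 1 / 2 := by rw [div_le_iff₀ ht]; linarith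
  linarith

theorem abs_bump_sub_le {t : ℝ} (ht : 0 < t) (x y z : Ω) :
    |bump t y z - bump t x z| ≤ dist x y / t := by
  refine (abs_max_sub_max_le_max _ _ _ _).trans ?_
  rw [sub_self, abs_zero]
  refine max_le (by positivity) ?_
  rw [show 1 - dist y z / t - (1 - dist x z / t) = (dist x z - dist y z) / t by ring, abs_div,
    abs_of_pos ht]
  gcongr
  exact abs_dist_sub_le x y z

end Bump

section Smoothing

variable {Ω : Type*} [MetricSpace Ω] [MeasurableSpace Ω] {μ : Measure Ω}

/-- The mean over `y ∈ B(x, t)` of `|f(x) - f(y)|`. -/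
def meanOscillation (μ : Measure Ω) (f : Ω → ℝ) (t : ℝ) (x : Ω) : ℝ≥0∞ :=
  ⨍⁻ y in ball x t, ‖f x - f y‖ₑ ∂μ

theorem measurable_meanOscillation [OpensMeasurableSpace Ω] [SecondCountableTopology Ω] [SFinite μ]
    {f : Ω → ℝ} (hf : Measurable f) (t : ℝ) : Measurable (meanOscillation μ f t) :=
  measurable_setLAverage_ball (F := fun z => ‖f z.1 - f z.2‖ₑ)
    ((hf.comp measurable_fst).sub (hf.comp measurable_snd)).enorm t

theorem measurable_bump [OpensMeasurableSpace Ω] [SecondCountableTopology Ω] (t : ℝ) :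
    Measurable fun p : Ω × Ω => bump t p.1 p.2 :=
  measurable_const.max (measurable_const.sub ((measurable_fst.dist measurable_snd).div_const t))

theorem integrable_bump_mul [OpensMeasurableSpace Ω] [SecondCountableTopology Ω] {t : ℝ}
    (ht : 0 < t) {x : Ω} {f : Ω → ℝ} (hf : IntegrableOn f (ball x t) μ) :
    Integrable (fun z => bump t x z * f z) μ := by
  have hb : Measurable fun z => bump t x z := (measurable_bump t).comp measurable_prodMk_left
  rw [← integrableOn_iff_integrable_of_support_subset (s := ball x t)]
  · refine hf.bdd_mul (c := 1) hb.aestronglyMeasurable (Filter.Eventually.of_forall fun z => ?_)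
    rw [Real.norm_of_nonneg (bump_nonneg _ _ _)]
    exact bump_le_one ht x z
  · intro z hz
    by_contra hcon
    exact hz (by simp [bump_eq_zero ht hcon])

/-- The mean of `f` with respect to the cone over `B(x, t)`. -/
def smoothing (μ : Measure Ω) (t : ℝ) (f : Ω → ℝ) (x : Ω) : ℝ :=
  (∫ z, bump t x z * f z ∂μ) / ∫ z, bump t x z ∂μ

theorem measurable_smoothing [OpensMeasurableSpace Ω] [SecondCountableTopology Ω] [SFinite μ]
    (t : ℝ) {f : Ω → ℝ} (hf : Measurable f) : Measurable (smoothing μ t f) := by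
  have h1 : StronglyMeasurable fun x => ∫ z, bump t x z * f z ∂μ :=
    StronglyMeasurable.integral_prod_right (f := fun x z => bump t x z * f z)
      ((measurable_bump t).mul (hf.comp measurable_snd)).stronglyMeasurable
  have h2 : StronglyMeasurable fun x => ∫ z, bump t x z ∂μ :=
    StronglyMeasurable.integral_prod_right (f := fun x z => bump t x z)
      (measurable_bump t).stronglyMeasurable
  exact h1.measurable.div h2.measurable

theorem integrable_bump [OpensMeasurableSpace Ω] [SecondCountableTopology Ω] (hΩ : IsRDSpace μ)
    {t : ℝ} (ht : 0 < t) (x : Ω) : Integrable (bump t x) μ := by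
  have h1 : IntegrableOn (fun _ : Ω => (1 : ℝ)) (ball x t) μ :=
    integrableOn_const (hΩ.ball_lt_top x t ht).ne
  simpa using integrable_bump_mul ht h1

theorem IsRDSpace.exists_ball_le_integral_bump [OpensMeasurableSpace Ω] [SecondCountableTopology Ω]
    (hΩ : IsRDSpace μ) : ∃ D : ℝ≥0, ∀ (t : ℝ) (x : Ω), 0 < t →
      0 < ∫ z, bump t x z ∂μ ∧ μ (ball x t) ≤ D * ENNReal.ofReal (∫ z, bump t x z ∂μ) := by
  obtain ⟨C, hC0, hC⟩ := hΩ.exists_doubling (l := 2) (by norm_num)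
  refine ⟨C * 2, fun t x ht => ?_⟩
  have hfin := hΩ.ball_lt_top x (t / 2) (by positivity)
  have hpos := hΩ.ball_pos x (t / 2) (by positivity)
  have h1 : μ.real (ball x (t / 2)) * (1 / 2) ≤ ∫ z, bump t x z ∂μ := by
    rw [← smul_eq_mul, ← integral_indicator_const _ measurableSet_ball]
    refine integral_mono ((integrable_indicator_iff measurableSet_ball).2
      (integrableOn_const hfin.ne)) (integrable_bump hΩ ht x) fun z => ?_
    by_cases hz : z ∈ ball x (t / 2)
    · simpa [hz] using half_le_bump ht hz
    · simpa [hz] using bump_nonneg t x z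
  have hr : 0 < μ.real (ball x (t / 2)) := ENNReal.toReal_pos hpos.ne' hfin.ne
  refine ⟨lt_of_lt_of_le (by positivity) h1, ?_⟩
  calc μ (ball x t) = μ (ball x (2 * (t / 2))) := by rw [mul_div_cancel₀ t two_ne_zero]
    _ ≤ C * μ (ball x (t / 2)) := hC x (t / 2) (by positivity)
    _ = C * (2 * ENNReal.ofReal (μ.real (ball x (t / 2)) * (1 / 2))) := by
        rw [ENNReal.ofReal_mul (by positivity), Measure.real, ENNReal.ofReal_toReal hfin.ne,
          one_div, ENNReal.ofReal_inv_of_pos (by norm_num), ENNReal.ofReal_ofNat,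
          mul_comm (2 : ℝ≥0∞), mul_assoc, ENNReal.inv_mul_cancel (by simp) (by simp), mul_one]
    _ ≤ C * (2 * ENNReal.ofReal (∫ z, bump t x z ∂μ)) := by gcongr
    _ = _ := by push_cast; ring

theorem IsRDSpace.exists_enorm_sub_smoothing_le [OpensMeasurableSpace Ω]
    [SecondCountableTopology Ω] (hΩ : IsRDSpace μ) :
    ∃ C : ℝ≥0, ∀ (f : Ω → ℝ) (t : ℝ) (x : Ω), 0 < t → IntegrableOn f (ball x t) μ →
      ‖f x - smoothing μ t f x‖ₑ ≤ C * meanOscillation μ f t x := by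
  obtain ⟨D, hD⟩ := hΩ.exists_ball_le_integral_bump
  refine ⟨D, fun f t x ht hf => ?_⟩
  obtain ⟨hV, hVD⟩ := hD t x ht
  set V := ∫ z, bump t x z ∂μ with hVdef
  have hid : V * (f x - smoothing μ t f x) = ∫ z, bump t x z * (f x - f z) ∂μ := by
    simp_rw [mul_sub]
    rw [integral_sub ((integrable_bump hΩ ht x).mul_const _) (integrable_bump_mul ht hf),
      integral_mul_const, smoothing, mul_div_cancel₀ _ hV.ne']
  have h1 : ENNReal.ofReal V * ‖f x - smoothing μ t f x‖ₑ ≤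
      ENNReal.ofReal V * (D * meanOscillation μ f t x) := by
    calc ENNReal.ofReal V * ‖f x - smoothing μ t f x‖ₑ
        = ‖∫ z, bump t x z * (f x - f z) ∂μ‖ₑ := by
          rw [← hid, enorm_mul, Real.enorm_of_nonneg hV.le]
      _ ≤ ∫⁻ z, ‖bump t x z * (f x - f z)‖ₑ ∂μ := enorm_integral_le_lintegral_enorm _
      _ ≤ ∫⁻ z, (ball x t).indicator (fun z => ‖f x - f z‖ₑ) z ∂μ := by
          refine lintegral_mono fun z => ?_
          by_cases hz : z ∈ ball x t
          · rw [indicator_of_mem hz, enorm_mul, Real.enorm_of_nonneg (bump_nonneg _ _ _)]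
            refine mul_le_of_le_one_left zero_le ?_
            exact ENNReal.ofReal_le_one.2 (bump_le_one ht x z)
          · simp [bump_eq_zero ht hz]
      _ = μ (ball x t) * meanOscillation μ f t x := by
          rw [lintegral_indicator measurableSet_ball, meanOscillation,
            measure_mul_setLAverage _ (hΩ.ball_lt_top x t ht).ne]
      _ ≤ D * ENNReal.ofReal V * meanOscillation μ f t x := by gcongr
      _ = _ := by ring
  exact (ENNReal.mul_le_mul_iff_right (ENNReal.ofReal_pos.2 hV).ne' ENNReal.ofReal_ne_top).1 h1

/-- Lipschitz estimate for the smoothing at distances below the scale `t`. -/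
theorem IsRDSpace.exists_enorm_smoothing_sub_le [OpensMeasurableSpace Ω]
    [SecondCountableTopology Ω] (hΩ : IsRDSpace μ) :
    ∃ C : ℝ≥0, ∀ (f : Ω → ℝ) (t : ℝ) (x y : Ω), 0 < t →
      IntegrableOn f (ball x t) μ → IntegrableOn f (ball y t) μ → dist x y < t →
      ‖smoothing μ t f x - smoothing μ t f y‖ₑ ≤ C * ENNReal.ofReal (dist x y / t) *
        (‖f x - smoothing μ t f x‖ₑ + meanOscillation μ f (2 * t) x) := by
  obtain ⟨D, hD⟩ := hΩ.exists_ball_le_integral_bump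
  obtain ⟨C, hC0, hC⟩ := hΩ.exists_doubling (l := 3) (by norm_num)
  refine ⟨C * D, fun f t x y ht hfx hfy hxy => ?_⟩
  obtain ⟨hVx, -⟩ := hD t x ht
  obtain ⟨hV, hVD⟩ := hD t y ht
  set c := smoothing μ t f x with hc
  set V := ∫ z, bump t y z ∂μ with hVdef
  have hfin2 := (hΩ.ball_lt_top x (2 * t) (by positivity)).ne
  have hix : Integrable (fun z => bump t x z * (c - f z)) μ := by
    simp_rw [mul_sub]
    exact ((integrable_bump hΩ ht x).mul_const _).sub (integrable_bump_mul ht hfx)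
  have hiy : Integrable (fun z => bump t y z * (c - f z)) μ := by
    simp_rw [mul_sub]
    exact ((integrable_bump hΩ ht y).mul_const _).sub (integrable_bump_mul ht hfy)
  -- the value `c` makes the mean of `c - f` over the cone at `x` vanish
  have hzero : ∫ z, bump t x z * (c - f z) ∂μ = 0 := by
    simp_rw [mul_sub]
    rw [integral_sub ((integrable_bump hΩ ht x).mul_const _) (integrable_bump_mul ht hfx),
      integral_mul_const, hc, smoothing, mul_div_cancel₀ _ hVx.ne', sub_self]
  have hid : V * (c - smoothing μ t f y) = ∫ z, (bump t y z - bump t x z) * (c - f z) ∂μ := by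
    simp_rw [sub_mul (bump t y _)]
    rw [integral_sub hiy hix, hzero, sub_zero]
    simp_rw [mul_sub]
    rw [integral_sub ((integrable_bump hΩ ht y).mul_const _) (integrable_bump_mul ht hfy),
      integral_mul_const, smoothing, mul_div_cancel₀ _ hV.ne']
  have hball : μ (ball x (2 * t)) ≤ C * (D * ENNReal.ofReal V) := by
    refine (measure_mono (ball_subset_ball' ?_)).trans ((hC y t ht).trans ?_)
    · linarith
    · gcongr
  have h1 : ENNReal.ofReal V * ‖c - smoothing μ t f y‖ₑ ≤
      ENNReal.ofReal V * (((C * D : ℝ≥0) : ℝ≥0∞) * ENNReal.ofReal (dist x y / t) *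
        (‖f x - c‖ₑ + meanOscillation μ f (2 * t) x)) := by
    calc ENNReal.ofReal V * ‖c - smoothing μ t f y‖ₑ
        = ‖∫ z, (bump t y z - bump t x z) * (c - f z) ∂μ‖ₑ := by
          rw [← hid, enorm_mul, Real.enorm_of_nonneg hV.le]
      _ ≤ ∫⁻ z, ‖(bump t y z - bump t x z) * (c - f z)‖ₑ ∂μ := enorm_integral_le_lintegral_enorm _
      _ ≤ ∫⁻ z, (ball x (2 * t)).indicator (fun z => ENNReal.ofReal (dist x y / t) *
            (‖f x - c‖ₑ + ‖f x - f z‖ₑ)) z ∂μ := by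
          refine lintegral_mono fun z => ?_
          by_cases hz : z ∈ ball x (2 * t)
          · rw [indicator_of_mem hz, enorm_mul]
            refine mul_le_mul' ?_ ?_
            · rw [Real.enorm_eq_ofReal_abs]
              exact ENNReal.ofReal_le_ofReal (abs_bump_sub_le ht x y z)
            · rw [show c - f z = (f x - f z) - (f x - c) by ring, add_comm]
              exact enorm_sub_le
          · have hzx : z ∉ ball x t := fun h => hz (ball_subset_ball (by linarith) h)
            have hzy : z ∉ ball y t := fun h => hz (ball_subset_ball'
              (by rw [dist_comm]; linarith) h)
            simp [bump_eq_zero ht hzx, bump_eq_zero ht hzy]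
      _ = ENNReal.ofReal (dist x y / t) * (μ (ball x (2 * t)) *
            (‖f x - c‖ₑ + meanOscillation μ f (2 * t) x)) := by
          rw [lintegral_indicator measurableSet_ball,
            lintegral_const_mul' _ _ ENNReal.ofReal_ne_top,
            lintegral_add_left measurable_const, setLIntegral_const, mul_add (μ _),
            meanOscillation,
            measure_mul_setLAverage _ hfin2, mul_comm ‖f x - c‖ₑ]
      _ ≤ ENNReal.ofReal (dist x y / t) * (C * (D * ENNReal.ofReal V) *
            (‖f x - c‖ₑ + meanOscillation μ f (2 * t) x)) := by gcongr
      _ = _ := by push_cast; ring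
  exact (ENNReal.mul_le_mul_iff_right (ENNReal.ofReal_pos.2 hV).ne' ENNReal.ofReal_ne_top).1 h1

/-- Increments of `f` itself are controlled by mean oscillations at the scale of the distance. -/
theorem IsRDSpace.exists_enorm_sub_le [OpensMeasurableSpace Ω] (hΩ : IsRDSpace μ) :
    ∃ C : ℝ≥0, ∀ (f : Ω → ℝ) (r : ℝ) (x y : Ω), Measurable f → 0 < r → dist x y < r →
      ‖f x - f y‖ₑ ≤ meanOscillation μ f r x + C * meanOscillation μ f (2 * r) y := by
  obtain ⟨C, hC0, hC⟩ := hΩ.exists_doubling (l := 3) (by norm_num)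
  refine ⟨C, fun f r x y hf hr hxy => ?_⟩
  have hpos := (hΩ.ball_pos x r hr).ne'
  have hfin := (hΩ.ball_lt_top x r hr).ne
  have hm : ∀ a, Measurable fun z => ‖f a - f z‖ₑ := fun a => (measurable_const.sub hf).enorm
  calc ‖f x - f y‖ₑ = ⨍⁻ _ in ball x r, ‖f x - f y‖ₑ ∂μ := (setLAverage_const hpos hfin _).symm
    _ ≤ ⨍⁻ z in ball x r, (‖f x - f z‖ₑ + ‖f y - f z‖ₑ) ∂μ := by
        refine lintegral_mono fun z => ?_
        rw [show f x - f y = (f x - f z) - (f y - f z) by ring]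
        exact enorm_sub_le
    _ = meanOscillation μ f r x + ⨍⁻ z in ball x r, ‖f y - f z‖ₑ ∂μ := lintegral_add_left (hm x) _
    _ ≤ _ := by
        gcongr
        refine setLAverage_le_of_subset (ball_subset_ball' (by linarith)) (by exact_mod_cast hC0)
          ENNReal.coe_ne_top ?_ _
        refine (measure_mono (ball_subset_ball' ?_)).trans (hC x r hr)
        rw [dist_comm]; linarith

theorem meanOscillation_le_tsum (f : Ω → ℝ) {l : ℝ} (hl : 0 < l) (t : ℝ) (x : Ω) (j : ℕ) :
    meanOscillation μ f (l ^ j * t) x ≤ ENNReal.ofReal (l ^ j) *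
      ∑' j : ℕ, ENNReal.ofReal ((l ^ j)⁻¹) * meanOscillation μ f (l ^ j * t) x := by
  have hlj : 0 < l ^ j := by positivity
  calc meanOscillation μ f (l ^ j * t) x
      = ENNReal.ofReal (l ^ j) *
          (ENNReal.ofReal ((l ^ j)⁻¹) * meanOscillation μ f (l ^ j * t) x) := by
        rw [← mul_assoc, ← ENNReal.ofReal_mul hlj.le, mul_inv_cancel₀ hlj.ne', ENNReal.ofReal_one,
          one_mul]
    _ ≤ _ := by
        gcongr
        exact ENNReal.le_tsum (f := fun j : ℕ => ENNReal.ofReal ((l ^ j)⁻¹) *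
          meanOscillation μ f (l ^ j * t) x) j

/-- The pointwise estimates behind the upper bound for the `K`-functional: at the scale `t`, the
smoothing is close to `f`, and the sum `∑ l ^ (-j)` times the mean oscillations at the scales
`l ^ j t` is, up to a factor `1 / t`, a `1`-gradient of it. -/
theorem IsRDSpace.exists_smoothing_le [OpensMeasurableSpace Ω]
    [SecondCountableTopology Ω] (hΩ : IsRDSpace μ) {l : ℝ} (hl : 2 ≤ l) :
    ∃ C : ℝ≥0, ∀ (f : Ω → ℝ) (t : ℝ), Measurable f → (∀ x r, 0 < r → IntegrableOn f (ball x r) μ) →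
      0 < t → (∀ x, ‖f x - smoothing μ t f x‖ₑ ≤ C *
          ∑' j : ℕ, ENNReal.ofReal ((l ^ j)⁻¹) * meanOscillation μ f (l ^ j * t) x) ∧
        ∀ x y, ‖smoothing μ t f x - smoothing μ t f y‖ₑ ≤ C * ENNReal.ofReal (dist x y / t) *
          ((∑' j : ℕ, ENNReal.ofReal ((l ^ j)⁻¹) * meanOscillation μ f (l ^ j * t) x) +
            ∑' j : ℕ, ENNReal.ofReal ((l ^ j)⁻¹) * meanOscillation μ f (l ^ j * t) y) := by
  obtain ⟨C₁, h₁⟩ := hΩ.exists_enorm_sub_smoothing_le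
  obtain ⟨C₂, h₂⟩ := hΩ.exists_enorm_smoothing_sub_le
  obtain ⟨C₃, h₃⟩ := hΩ.exists_enorm_sub_le
  obtain ⟨D, hD0, hD⟩ := hΩ.exists_doubling (l := l) (by linarith)
  have hl0 : 0 < l := by linarith
  set L : ℝ≥0 := l.toNNReal with hL
  have hLl : ENNReal.ofReal l = L := rfl
  refine ⟨C₁ + C₂ * (C₁ + D * L) + (C₁ + L + C₃ * (D * L ^ 2)), fun f t hf hint ht => ?_⟩
  set S : Ω → ℝ≥0∞ := fun x =>
    ∑' j : ℕ, ENNReal.ofReal ((l ^ j)⁻¹) * meanOscillation μ f (l ^ j * t) x with hS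
  have hosc : ∀ (j : ℕ) x, meanOscillation μ f (l ^ j * t) x ≤ ENNReal.ofReal (l ^ j) * S x :=
    fun j x => meanOscillation_le_tsum f hl0 t x j
  have hosc2 : ∀ r x, 0 < r → meanOscillation μ f (2 * r) x ≤ D * meanOscillation μ f (l * r) x :=
    fun r x hr => setLAverage_le_of_subset (ball_subset_ball (by gcongr)) (by exact_mod_cast hD0)
      (ENNReal.natCast_ne_top _)
      ((hD x r hr).trans (by gcongr; linarith)) _
  have hA : ∀ x, ‖f x - smoothing μ t f x‖ₑ ≤ C₁ * S x := fun x => by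
    refine (h₁ f t x ht (hint x t ht)).trans ?_
    have := hosc 0 x
    simp only [pow_zero, one_mul, ENNReal.ofReal_one] at this
    gcongr
  constructor
  · intro x
    refine (hA x).trans ?_
    gcongr
    exact le_add_right (le_add_right le_rfl)
  · intro x y
    set q := ENNReal.ofReal (dist x y / t) with hq
    change ‖smoothing μ t f x - smoothing μ t f y‖ₑ ≤ _ * q * (S x + S y)
    -- below the scale `t` the smoothing is Lipschitz; above it, compare it with `f` at both points
    rcases lt_or_ge (dist x y) t with hd | hd
    · have h1l : meanOscillation μ f (l * t) x ≤ L * S x := by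
        have := hosc 1 x
        rwa [pow_one, hLl] at this
      calc ‖smoothing μ t f x - smoothing μ t f y‖ₑ
          ≤ C₂ * q * (‖f x - smoothing μ t f x‖ₑ + meanOscillation μ f (2 * t) x) :=
            h₂ f t x y ht (hint x t ht) (hint y t ht) hd
        _ ≤ C₂ * q * (C₁ * S x + D * (L * S x)) := by
            gcongr
            · exact hA x
            · exact (hosc2 t x ht).trans (by gcongr)
        _ = ((C₂ * (C₁ + D * L) : ℝ≥0) : ℝ≥0∞) * q * S x := by push_cast; ring
        _ ≤ _ := by
            gcongr
            · exact le_add_right (le_add_left le_rfl)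
            · exact le_self_add
    · have hdt : 1 ≤ dist x y / t := by rwa [le_div_iff₀ ht, one_mul]
      have hq1 : 1 ≤ q := ENNReal.one_le_ofReal.2 hdt
      obtain ⟨k, hk1, hk2⟩ := exists_nat_pow_near hdt (show 1 < l by linarith)
      have hr : 0 < l ^ (k + 1) * t := by positivity
      have hkq : ENNReal.ofReal (l ^ k) ≤ q := ENNReal.ofReal_le_ofReal hk1
      have hp1 : ENNReal.ofReal (l ^ (k + 1)) ≤ L * q := by
        rw [pow_succ', ENNReal.ofReal_mul hl0.le, hLl]
        gcongr
      have hp2 : ENNReal.ofReal (l ^ (k + 2)) ≤ L ^ 2 * q := by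
        rw [pow_succ', ENNReal.ofReal_mul hl0.le, hLl, pow_two, mul_assoc]
        gcongr
      have hfxy : ‖f x - f y‖ₑ ≤ L * q * S x + C₃ * (D * (L ^ 2 * q * S y)) := by
        refine (h₃ f (l ^ (k + 1) * t) x y hf hr ((div_lt_iff₀ ht).1 hk2)).trans ?_
        gcongr
        · exact (hosc (k + 1) x).trans (by gcongr)
        · refine (hosc2 _ y hr).trans ?_
          gcongr
          rw [← mul_assoc, ← pow_succ']
          exact (hosc (k + 2) y).trans (by gcongr)
      calc ‖smoothing μ t f x - smoothing μ t f y‖ₑ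
          = ‖(f x - f y) - (f x - smoothing μ t f x) + (f y - smoothing μ t f y)‖ₑ := by
            congr 1; ring
        _ ≤ ‖f x - f y‖ₑ + ‖f x - smoothing μ t f x‖ₑ + ‖f y - smoothing μ t f y‖ₑ :=
            (enorm_add_le _ _).trans (by gcongr; exact enorm_sub_le)
        _ ≤ (L * q * S x + C₃ * (D * (L ^ 2 * q * S y))) + C₁ * S x + C₁ * S y := by
            gcongr
            · exact hA x
            · exact hA y
        _ ≤ (L * q * (S x + S y) + C₃ * (D * (L ^ 2 * q * (S x + S y)))) +
              (C₁ * S x + C₁ * S y) * q := by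
            rw [add_assoc]
            gcongr
            · exact le_self_add
            · exact le_add_self
            · exact le_mul_of_one_le_right zero_le hq1
        _ = ((C₁ + L + C₃ * (D * L ^ 2) : ℝ≥0) : ℝ≥0∞) * q * (S x + S y) := by push_cast; ring
        _ ≤ _ := mul_le_mul_left (mul_le_mul_left (ENNReal.coe_le_coe.2 le_add_self) q) _

end Smoothing

/-! ### Moduli of continuity and the `K`-functional -/

section KFunctional

variable {Ω : Type*} [MetricSpace Ω] [MeasurableSpace Ω] {μ : Measure Ω}
  {X : (Ω → ℝ≥0∞) → ℝ≥0∞}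

theorem modulus_congr_ae [OpensMeasurableSpace Ω] [SecondCountableTopology Ω] [SFinite μ]
    (hX : IsRINorm μ X) {f g : Ω → ℝ} (hf : Measurable f) (hg : Measurable g) (hfg : f =ᵐ[μ] g)
    (t : ℝ) : modulus μ X f t = modulus μ X g t := by
  refine hX.congr_ae (measurable_meanOscillation hf t) (measurable_meanOscillation hg t) ?_
  filter_upwards [hfg] with x hx
  refine laverage_congr (ae_restrict_of_ae ?_)
  filter_upwards [hfg] with y hy
  rw [hx, hy]

theorem modulus_add_le [OpensMeasurableSpace Ω] [SecondCountableTopology Ω] [SFinite μ]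
    (hX : IsRINorm μ X) {f g : Ω → ℝ} (hf : Measurable f) (hg : Measurable g) (t : ℝ) :
    modulus μ X (fun x => f x + g x) t ≤ modulus μ X f t + modulus μ X g t := by
  have hmf := measurable_meanOscillation (μ := μ) hf t
  have hmg := measurable_meanOscillation (μ := μ) hg t
  refine le_trans (hX.mono' (measurable_meanOscillation (hf.add hg) t) (hmf.add hmg) fun x => ?_)
    (hX.add_le _ _ hmf hmg)
  change _ ≤ meanOscillation μ f t x + meanOscillation μ g t x
  calc ⨍⁻ y in ball x t, ‖(f x + g x) - (f y + g y)‖ₑ ∂μ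
      ≤ ⨍⁻ y in ball x t, (‖f x - f y‖ₑ + ‖g x - g y‖ₑ) ∂μ := by
        refine lintegral_mono fun y => ?_
        rw [add_sub_add_comm]
        exact enorm_add_le _ _
    _ = _ := lintegral_add_left ((measurable_const.sub hf).enorm) _

theorem laverage_const_add_le {x : Ω} {t : ℝ} (a : ℝ≥0∞) (g : Ω → ℝ≥0∞) :
    ⨍⁻ y in ball x t, (a + g y) ∂μ ≤ a + ⨍⁻ y in ball x t, g y ∂μ := by
  rw [laverage_eq, laverage_eq, lintegral_add_left measurable_const, lintegral_const,
    ENNReal.add_div]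
  gcongr
  exact ENNReal.div_le_of_le_mul le_rfl

/-- The modulus is bounded by the norm in `X`, and by `t` times the norm of any `1`-gradient. -/
theorem IsRDSpace.exists_modulus_le [BorelSpace Ω] [NullSingletonClass μ]
    [SecondCountableTopology Ω] [SFinite μ] (hΩ : IsRDSpace μ) (hX : IsRINorm μ X) :
    ∃ C : ℝ≥0, C ≠ 0 ∧
      (∀ (f : Ω → ℝ) (t : ℝ), Measurable f → 0 < t →
        modulus μ X f t ≤ C * X (fun x => ‖f x‖ₑ)) ∧
      ∀ (f : Ω → ℝ) (g : Ω → ℝ≥0) (t : ℝ), Measurable f → 0 < t → IsOneGradient μ f g →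
        modulus μ X f t ≤ C * (ENNReal.ofReal t * X (fun x => g x)) := by
  obtain ⟨C, hC⟩ := hΩ.exists_laverage_ball_le hX
  -- both bounds compare the mean oscillation at `x` with `h(x)` plus the mean of `h` over the ball
  have key : ∀ (f : Ω → ℝ) (h : Ω → ℝ≥0∞) (t : ℝ), Measurable f → Measurable h → 0 < t →
      (∀ᵐ x ∂μ, ∀ᵐ y ∂μ, y ∈ ball x t → ‖f x - f y‖ₑ ≤ h x + h y) →
      modulus μ X f t ≤ (1 + C : ℝ≥0) * X h := by
    intro f h t hf hh ht hle
    have hm : Measurable fun x => ⨍⁻ y in ball x t, h y ∂μ :=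
      measurable_setLAverage_ball (hh.comp measurable_snd) t
    calc modulus μ X f t ≤ X (h + fun x => ⨍⁻ y in ball x t, h y ∂μ) := by
          refine hX.mono _ _ (measurable_meanOscillation hf t) (hh.add hm) ?_
          filter_upwards [hle] with x hx
          refine le_trans ?_ (laverage_const_add_le (h x) h)
          exact laverage_mono_ae ((ae_restrict_iff' measurableSet_ball).2 hx)
      _ ≤ X h + C * X h := (hX.add_le _ _ hh hm).trans (by gcongr; exact hC t h ht hh)
      _ = _ := by push_cast; ring
  refine ⟨1 + C, by positivity, fun f t hf ht => ?_, fun f g t hf ht hg => ?_⟩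
  · refine key f _ t hf hf.enorm ht (Filter.Eventually.of_forall fun x =>
      Filter.Eventually.of_forall fun y _ => enorm_sub_le)
  · obtain ⟨hgm, N, hN, hgN⟩ := hg
    rw [← hX.const_mul ENNReal.ofReal_ne_top hgm.coe_nnreal_ennreal]
    refine key f _ t hf (hgm.coe_nnreal_ennreal.const_mul _) ht ?_
    have hae : ∀ᵐ x ∂μ, x ∉ N := measure_eq_zero_iff_ae_notMem.1 hN
    filter_upwards [hae] with x hx
    filter_upwards [hae] with y hy hxy
    rw [← mul_add, Real.enorm_eq_ofReal_abs, ← ENNReal.coe_add, ← ENNReal.ofReal_coe_nnreal,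
      ← ENNReal.ofReal_mul ht.le]
    refine ENNReal.ofReal_le_ofReal ((hgN x hx y hy).trans ?_)
    push_cast
    have := (mem_ball'.1 hxy).le
    gcongr

theorem le_mul_peetreK {V : Type*} [Add V] {A₀ A₁ : NormedSubset V} {f : V} {t : ℝ} {C : ℝ≥0}
    (hC : C ≠ 0) {m : ℝ≥0∞} (h : ∀ f₀ ∈ A₀.carrier, ∀ f₁ ∈ A₁.carrier, f = f₀ + f₁ →
      m ≤ C * (A₀.nrm f₀ + ENNReal.ofReal t * A₁.nrm f₁)) : m ≤ C * peetreK A₀ A₁ f t := by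
  rw [← ENNReal.inv_mul_le_iff (by exact_mod_cast hC) ENNReal.coe_ne_top]
  refine le_iInf₂ fun f₀ h₀ => le_iInf₂ fun f₁ h₁ => le_iInf fun hf => ?_
  rw [ENNReal.inv_mul_le_iff (by exact_mod_cast hC) ENNReal.coe_ne_top]
  exact h f₀ h₀ f₁ h₁ hf

theorem peetreK_le {V : Type*} [Add V] {A₀ A₁ : NormedSubset V} {f₀ f₁ : V} (t : ℝ)
    (h₀ : f₀ ∈ A₀.carrier) (h₁ : f₁ ∈ A₁.carrier) :
    peetreK A₀ A₁ (f₀ + f₁) t ≤ A₀.nrm f₀ + ENNReal.ofReal t * A₁.nrm f₁ :=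
  iInf₂_le_of_le f₀ h₀ (iInf₂_le_of_le f₁ h₁ (iInf_le_of_le rfl le_rfl))

theorem peetreK_anti {V : Type*} [Add V] {A₀ A₁ B₁ : NormedSubset V}
    (hsub : A₁.carrier ⊆ B₁.carrier) (hle : ∀ f, B₁.nrm f ≤ A₁.nrm f) (f : V) (t : ℝ) :
    peetreK A₀ B₁ f t ≤ peetreK A₀ A₁ f t := by
  refine le_iInf₂ fun f₀ h₀ => le_iInf₂ fun f₁ h₁ => le_iInf fun hf => ?_
  rw [hf]
  refine (peetreK_le t h₀ (hsub h₁)).trans ?_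
  gcongr
  exact hle f₁

theorem measurable_coeFn_enorm {α : Type*} [MeasurableSpace α] {μ : Measure α} (f : α →ₘ[μ] ℝ) :
    Measurable fun x => ‖f x‖ₑ :=
  f.measurable.enorm

theorem functionSpace_nrm_add_le {α : Type*} [MeasurableSpace α] {μ : Measure α}
    {X : (α → ℝ≥0∞) → ℝ≥0∞} (hX : IsRINorm μ X) (f g : α →ₘ[μ] ℝ) :
    (functionSpace μ X).nrm (f + g) ≤ (functionSpace μ X).nrm f + (functionSpace μ X).nrm g := by
  refine le_trans (hX.mono _ (fun x => ‖f x‖ₑ + ‖g x‖ₑ) (measurable_coeFn_enorm _)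
    ((measurable_coeFn_enorm f).add (measurable_coeFn_enorm g)) ?_)
    (hX.add_le _ _ (measurable_coeFn_enorm f) (measurable_coeFn_enorm g))
  filter_upwards [AEEqFun.coeFn_add f g] with x hx
  rw [hx]
  exact enorm_add_le _ _

theorem functionSpace_nrm_sub_le {α : Type*} [MeasurableSpace α] {μ : Measure α}
    {X : (α → ℝ≥0∞) → ℝ≥0∞} (hX : IsRINorm μ X) (f g : α →ₘ[μ] ℝ) :
    (functionSpace μ X).nrm (f - g) ≤ (functionSpace μ X).nrm f + (functionSpace μ X).nrm g := by
  refine le_trans (hX.mono _ (fun x => ‖f x‖ₑ + ‖g x‖ₑ) (measurable_coeFn_enorm _)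
    ((measurable_coeFn_enorm f).add (measurable_coeFn_enorm g)) ?_)
    (hX.add_le _ _ (measurable_coeFn_enorm f) (measurable_coeFn_enorm g))
  filter_upwards [AEEqFun.coeFn_sub f g] with x hx
  rw [hx]
  exact enorm_sub_le

theorem IsRDSpace.exists_modulus_le_peetreK [BorelSpace Ω] [NullSingletonClass μ]
    [SecondCountableTopology Ω] [SFinite μ] (hΩ : IsRDSpace μ) (hX : IsRINorm μ X) :
    ∃ C : ℝ≥0, ∀ (f : Ω →ₘ[μ] ℝ) (t : ℝ), 0 < t →
      modulus μ X f t ≤ C * peetreK (functionSpace μ X) (homHajlaszSobolev μ X) f t := by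
  obtain ⟨C, hC0, h₁, h₂⟩ := hΩ.exists_modulus_le hX
  refine ⟨C, fun f t ht => le_mul_peetreK hC0 fun f₀ hf₀ f₁ hf₁ hf => ?_⟩
  have hC0' : (C : ℝ≥0∞) ≠ 0 := by exact_mod_cast hC0
  have ht' : ENNReal.ofReal t ≠ 0 := (ENNReal.ofReal_pos.2 ht).ne'
  have hgrad : modulus μ X f₁ t ≤ C * (ENNReal.ofReal t * (homHajlaszSobolev μ X).nrm f₁) := by
    rw [← ENNReal.inv_mul_le_iff hC0' ENNReal.coe_ne_top,
      ← ENNReal.inv_mul_le_iff ht' ENNReal.ofReal_ne_top]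
    refine le_iInf₂ fun g hg => ?_
    rw [ENNReal.inv_mul_le_iff ht' ENNReal.ofReal_ne_top,
      ENNReal.inv_mul_le_iff hC0' ENNReal.coe_ne_top]
    exact h₂ f₁ g t f₁.measurable ht hg
  calc modulus μ X f t = modulus μ X (fun x => f₀ x + f₁ x) t := by
        refine modulus_congr_ae hX f.measurable (f₀.measurable.add f₁.measurable) ?_ t
        rw [hf]
        exact AEEqFun.coeFn_add f₀ f₁
    _ ≤ modulus μ X f₀ t + modulus μ X f₁ t := modulus_add_le hX f₀.measurable f₁.measurable t
    _ ≤ C * (functionSpace μ X).nrm f₀ +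
          C * (ENNReal.ofReal t * (homHajlaszSobolev μ X).nrm f₁) := by
        gcongr
        exact h₁ f₀ t f₀.measurable ht
    _ = _ := by rw [mul_add]

theorem integrableOn_ball_of_mem_sup (hΩ : IsRDSpace μ) {f : Ω →ₘ[μ] ℝ}
    (hf : f ∈ Lp ℝ 1 μ ⊔ Lp ℝ ∞ μ) (x : Ω) (r : ℝ) (hr : 0 < r) : IntegrableOn f (ball x r) μ := by
  obtain ⟨g, hg, h, hh, rfl⟩ := AddSubgroup.mem_sup.1 hf
  have : IsFiniteMeasure (μ.restrict (ball x r)) := ⟨by simpa using hΩ.ball_lt_top x r hr⟩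
  have h1 : IntegrableOn g (ball x r) μ :=
    (memLp_one_iff_integrable.1 (Lp.mem_Lp_iff_memLp.1 hg)).integrableOn
  have h2 : IntegrableOn h (ball x r) μ :=
    memLp_one_iff_integrable.1 (((Lp.mem_Lp_iff_memLp.1 hh).restrict _).mono_exponent le_top)
  refine (h1.add h2).congr ?_
  exact Filter.EventuallyEq.symm (ae_restrict_of_ae (AEEqFun.coeFn_add g h))

/-- R.i. spaces embed into `L¹ + L^∞`: a function of finite norm exceeds a large level only on a set
of finite measure, and is integrable there. -/
theorem mem_sup_of_mem_functionSpace (hΩ : IsRDSpace μ) [OpensMeasurableSpace Ω]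
    (hX : IsRINorm μ X) {f : Ω →ₘ[μ] ℝ}
    (hf : f ∈ (functionSpace μ X).carrier) : f ∈ Lp ℝ 1 μ ⊔ Lp ℝ ∞ μ := by
  have hfin : X (fun x => ‖f x‖ₑ) < ∞ := hf
  have hfm := measurable_coeFn_enorm f
  obtain ⟨n, hn⟩ : ∃ n : ℕ, μ {x | (n : ℝ≥0∞) < ‖f x‖ₑ} < ∞ := by
    rcases isEmpty_or_nonempty Ω with _ | ⟨⟨x₀⟩⟩
    · exact ⟨0, by simp [Measure.eq_zero_of_isEmpty μ]⟩
    by_contra! hcon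
    have hB := hΩ.ball_pos x₀ 1 one_pos
    have hind : Measurable ((ball x₀ 1).indicator (1 : Ω → ℝ≥0∞)) :=
      measurable_one.indicator measurableSet_ball
    have hle : ∀ n : ℕ, (n : ℝ≥0∞) * X ((ball x₀ 1).indicator 1) ≤ X (fun x => ‖f x‖ₑ) := by
      intro n
      rw [← hX.const_mul (ENNReal.natCast_ne_top n) hind]
      refine hX.le_of_distribution (hind.const_mul _) hfm fun t => ?_
      rcases lt_or_ge t n with ht | ht
      · refine le_top.trans ((hcon n).trans (measure_mono fun x hx => ?_))
        exact ht.trans hx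
      · refine le_of_eq_of_le ?_ zero_le
        convert measure_empty (μ := μ)
        refine eq_empty_of_forall_notMem fun x hx => absurd (lt_of_le_of_lt ht hx) (not_lt.2 ?_)
        refine mul_le_of_le_one_right zero_le ?_
        exact indicator_le_self' (fun _ _ => zero_le) x
    have hzero : X ((ball x₀ 1).indicator 1) = 0 := by
      by_contra hne
      obtain ⟨n, hn⟩ := ENNReal.exists_nat_mul_gt hne hfin.ne
      exact absurd (hle n) (not_le.2 hn)
    have h0 := (hX.eq_zero_iff _ hind).1 hzero
    rw [indicator_ae_eq_zero, Function.support_one, inter_univ] at h0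
    exact hB.ne' h0
  set A : Set Ω := {x | (n : ℝ≥0∞) < ‖f x‖ₑ} with hA
  have hAm : MeasurableSet A := measurableSet_lt measurable_const hfm
  obtain ⟨C, hC⟩ := hX.lintegral_le A hAm hn
  have h1m : Measurable (A.indicator f) := f.measurable.indicator hAm
  have h2m : Measurable (Aᶜ.indicator f) := f.measurable.indicator hAm.compl
  have h1 : MemLp (A.indicator f) 1 μ := by
    rw [memLp_one_iff_integrable, integrable_indicator_iff hAm]
    refine ⟨f.measurable.aestronglyMeasurable, ?_⟩
    exact (hC _ hfm).trans_lt (ENNReal.mul_lt_top ENNReal.coe_lt_top hfin)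
  have h2 : MemLp (Aᶜ.indicator f) ∞ μ := by
    refine memLp_top_of_bound h2m.aestronglyMeasurable n (Filter.Eventually.of_forall fun x => ?_)
    by_cases hx : x ∈ A
    · simp [hx]
    · have : ‖f x‖ₑ ≤ n := not_lt.1 hx
      rw [indicator_of_mem (show x ∈ Aᶜ from hx)]
      rw [← ofReal_norm, ← ENNReal.ofReal_natCast] at this
      exact (ENNReal.ofReal_le_ofReal_iff (Nat.cast_nonneg n)).1 this
  refine AddSubgroup.mem_sup.2 ⟨AEEqFun.mk _ h1m.aestronglyMeasurable, ?_,
    AEEqFun.mk _ h2m.aestronglyMeasurable, ?_, ?_⟩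
  · rw [Lp.mem_Lp_iff_memLp]
    exact (memLp_congr_ae (AEEqFun.coeFn_mk _ _)).2 h1
  · rw [Lp.mem_Lp_iff_memLp]
    exact (memLp_congr_ae (AEEqFun.coeFn_mk _ _)).2 h2
  · rw [AEEqFun.mk_add_mk]
    refine AEEqFun.ext ((AEEqFun.coeFn_mk _ _).trans (Filter.Eventually.of_forall fun x => ?_))
    by_cases hx : x ∈ A <;> simp [hx]

/-- The decomposition of `f` at the scale `t` into the smoothing and a remainder. -/
theorem IsRDSpace.exists_decomposition [BorelSpace Ω] [SecondCountableTopology Ω] [SFinite μ]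
    (hΩ : IsRDSpace μ) (hX : IsRINorm μ X) {l : ℝ} (hl : 2 ≤ l) :
    ∃ C : ℝ≥0, ∀ (f : Ω →ₘ[μ] ℝ) (t : ℝ), f ∈ Lp ℝ 1 μ ⊔ Lp ℝ ∞ μ → 0 < t →
      ∑' j : ℕ, ENNReal.ofReal ((l ^ j)⁻¹) * modulus μ X f (l ^ j * t) < ∞ →
      ∃ f₀ ∈ (functionSpace μ X).carrier, ∃ f₁ ∈ (homHajlaszSobolev μ X).carrier, f = f₀ + f₁ ∧
        (functionSpace μ X).nrm f₀ ≤
          C * ∑' j : ℕ, ENNReal.ofReal ((l ^ j)⁻¹) * modulus μ X f (l ^ j * t) ∧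
        ENNReal.ofReal t * (homHajlaszSobolev μ X).nrm f₁ ≤
          C * ∑' j : ℕ, ENNReal.ofReal ((l ^ j)⁻¹) * modulus μ X f (l ^ j * t) := by
  obtain ⟨C, hC⟩ := hΩ.exists_smoothing_le hl
  refine ⟨C, fun f t hf ht hfin => ?_⟩
  obtain ⟨h₁, h₂⟩ := hC f t f.measurable (integrableOn_ball_of_mem_sup hΩ hf) ht
  set S : Ω → ℝ≥0∞ := fun x =>
    ∑' j : ℕ, ENNReal.ofReal ((l ^ j)⁻¹) * meanOscillation μ f (l ^ j * t) x with hS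
  set σ := ∑' j : ℕ, ENNReal.ofReal ((l ^ j)⁻¹) * modulus μ X f (l ^ j * t) with hσ
  have hterm : ∀ j : ℕ, Measurable fun x =>
      ENNReal.ofReal ((l ^ j)⁻¹) * meanOscillation μ f (l ^ j * t) x := fun j =>
    (measurable_meanOscillation f.measurable _).const_mul _
  have hSm : Measurable S := Measurable.tsum hterm
  have hXS : X S ≤ σ := by
    refine (hX.tsum_le hterm).trans (ENNReal.tsum_le_tsum fun j => ?_)
    rw [hX.const_mul ENNReal.ofReal_ne_top (measurable_meanOscillation f.measurable _)]
    rfl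
  have hsm : Measurable (smoothing μ t f) := measurable_smoothing t f.measurable
  set f₁ : Ω →ₘ[μ] ℝ := AEEqFun.mk (smoothing μ t f) hsm.aestronglyMeasurable with hf₁
  have hf₁ae : f₁ =ᵐ[μ] smoothing μ t f := AEEqFun.coeFn_mk _ _
  have hσC : (C : ℝ≥0∞) * σ < ∞ := ENNReal.mul_lt_top ENNReal.coe_lt_top hfin
  have hn₀ : (functionSpace μ X).nrm (f - f₁) ≤ C * σ := by
    calc X (fun x => ‖(f - f₁) x‖ₑ) ≤ X (fun x => C * S x) := by
          refine hX.mono _ _ (measurable_coeFn_enorm _) (hSm.const_mul _) ?_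
          filter_upwards [AEEqFun.coeFn_sub f f₁, hf₁ae] with x hx hx'
          rw [hx, Pi.sub_apply, hx']
          exact h₁ x
      _ = C * X S := hX.const_mul ENNReal.coe_ne_top hSm
      _ ≤ C * σ := by gcongr
  have h₀mem : f - f₁ ∈ (functionSpace μ X).carrier := hn₀.trans_lt hσC
  -- `C S / t` is a `1`-gradient of the smoothing, once it is made finite on a null set
  have hScm : Measurable fun x => ENNReal.ofReal t⁻¹ * (C * S x) := (hSm.const_mul _).const_mul _
  have hg : IsOneGradient μ f₁ fun x => (ENNReal.ofReal t⁻¹ * (C * S x)).toNNReal := by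
    refine ⟨hScm.ennreal_toNNReal, {x | ¬ (S x < ∞ ∧ f₁ x = smoothing μ t f x)}, ?_, ?_⟩
    · exact ae_iff.1 ((hX.ae_lt_top hSm (hXS.trans_lt hfin)).and hf₁ae)
    · intro x hx y hy
      obtain ⟨hSx, hfx⟩ := not_not.1 hx
      obtain ⟨hSy, hfy⟩ := not_not.1 hy
      have hfinite : ∀ z, S z < ∞ → ENNReal.ofReal t⁻¹ * (C * S z) ≠ ∞ := fun z hz =>
        ENNReal.mul_ne_top ENNReal.ofReal_ne_top (ENNReal.mul_ne_top ENNReal.coe_ne_top hz.ne)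
      rw [hfx, hfy, ← ENNReal.ofReal_le_ofReal_iff (by positivity), ← Real.enorm_eq_ofReal_abs,
        ENNReal.ofReal_mul dist_nonneg, ← NNReal.coe_add, ENNReal.ofReal_coe_nnreal,
        ENNReal.coe_add, ENNReal.coe_toNNReal (hfinite x hSx), ENNReal.coe_toNNReal (hfinite y hSy)]
      refine (h₂ x y).trans (le_of_eq ?_)
      rw [div_eq_mul_inv, ENNReal.ofReal_mul dist_nonneg]
      ring
  have hn₁ : ENNReal.ofReal t * (homHajlaszSobolev μ X).nrm f₁ ≤ C * σ := by
    calc ENNReal.ofReal t * (homHajlaszSobolev μ X).nrm f₁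
        ≤ ENNReal.ofReal t *
            X (fun x => ((ENNReal.ofReal t⁻¹ * (C * S x)).toNNReal : ℝ≥0∞)) := by
          gcongr
          exact iInf₂_le _ hg
      _ ≤ ENNReal.ofReal t * X (fun x => ENNReal.ofReal t⁻¹ * (C * S x)) := by
          gcongr
          exact hX.mono' hScm.ennreal_toNNReal.coe_nnreal_ennreal hScm
            fun x => ENNReal.coe_toNNReal_le_self
      _ = C * X S := by
          rw [hX.const_mul ENNReal.ofReal_ne_top (hSm.const_mul _),
            hX.const_mul ENNReal.coe_ne_top hSm, ← mul_assoc, ← ENNReal.ofReal_mul ht.le,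
            mul_inv_cancel₀ ht.ne', ENNReal.ofReal_one, one_mul]
      _ ≤ C * σ := by gcongr
  have h₁mem : f₁ ∈ (homHajlaszSobolev μ X).carrier := by
    refine ⟨?_, ?_⟩
    · rw [← sub_sub_cancel f f₁]
      exact sub_mem hf (mem_sup_of_mem_functionSpace hΩ hX h₀mem)
    · change (homHajlaszSobolev μ X).nrm f₁ < ∞
      by_contra! hcon
      rw [top_le_iff.1 hcon, ENNReal.mul_top (ENNReal.ofReal_pos.2 ht).ne'] at hn₁
      exact absurd hn₁ (not_le.2 hσC)
  exact ⟨f - f₁, h₀mem, f₁, h₁mem, by abel, hn₀, hn₁⟩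

end KFunctional

/-! ### Convexifications -/

section Convexification

variable {α : Type*} {X : (α → ℝ≥0∞) → ℝ≥0∞} {p : ℝ}

theorem convexification_rpow (hp : 0 < p) (f : α → ℝ≥0∞) :
    convexification X p f ^ p = X (fun x => f x ^ p) := by
  rw [convexification, ← ENNReal.rpow_mul, one_div, inv_mul_cancel₀ hp.ne', ENNReal.rpow_one]

theorem convexification_le_iff (hp : 0 < p) {f : α → ℝ≥0∞} {a : ℝ≥0∞} :
    convexification X p f ≤ a ↔ X (fun x => f x ^ p) ≤ a ^ p := by
  rw [← convexification_rpow (X := X) hp f, ENNReal.rpow_le_rpow_iff hp]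

variable [MeasurableSpace α] {μ : Measure α}

theorem IsBanachFunctionNorm.convexification_add_le (hX : IsBanachFunctionNorm μ X) (hp : 1 ≤ p)
    {f g : α → ℝ≥0∞} (hf : Measurable f) (hg : Measurable g) :
    convexification X p (f + g) ≤ convexification X p f + convexification X p g := by
  have hp0 : 0 < p := by linarith
  set a := convexification X p f with ha
  set b := convexification X p g with hb
  have hae : ∀ h : α → ℝ≥0∞, Measurable h → convexification X p h = 0 → h =ᵐ[μ] 0 := by
    intro h hh h0
    rw [← nonpos_iff_eq_zero, convexification_le_iff hp0, ENNReal.zero_rpow_of_pos hp0,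
      nonpos_iff_eq_zero, hX.eq_zero_iff _ (hh.pow_const p)] at h0
    filter_upwards [h0] with x hx
    simpa [hp0, hp0.not_gt] using hx
  have hcongr : ∀ h k : α → ℝ≥0∞, Measurable h → Measurable k → h =ᵐ[μ] k →
      convexification X p h = convexification X p k := by
    intro h k hh hk hhk
    rw [convexification, convexification, hX.congr_ae (hh.pow_const p) (hk.pow_const p)]
    filter_upwards [hhk] with x hx
    rw [hx]
  rcases eq_or_ne a ∞ with h | haT
  · simp [h]
  rcases eq_or_ne b ∞ with h | hbT
  · simp [h]
  rcases eq_or_ne a 0 with h | ha0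
  · rw [h, zero_add, hb, hcongr (f + g) g (hf.add hg) hg]
    filter_upwards [hae f hf h] with x hx
    simp [hx]
  rcases eq_or_ne b 0 with h | hb0
  · rw [h, add_zero, ha, hcongr (f + g) f (hf.add hg) hf]
    filter_upwards [hae g hg h] with x hx
    simp [hx]
  set s := a + b with hs
  have hs0 : s ≠ 0 := by simp [hs, ha0]
  have hsT : s ≠ ∞ := by simp [hs, haT, hbT]
  have hw : a / s + b / s = 1 := by rw [← ENNReal.add_div, ENNReal.div_self hs0 hsT]
  -- convexity of `t ^ p` with the weights `a / s` and `b / s`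
  have hcancel : ∀ c : ℝ≥0∞, c ≠ 0 → c ≠ ∞ → ∀ y : ℝ≥0∞, c / s * (s / c * y) = y := by
    intro c hc0 hcT y
    rw [← mul_assoc, ← mul_div_assoc, ENNReal.div_mul_cancel hs0 hsT, ENNReal.div_self hc0 hcT,
      one_mul]
  have hpow : ∀ c : ℝ≥0∞, c ≠ 0 → c ≠ ∞ → ∀ h : α → ℝ≥0∞, Measurable h →
      convexification X p h = c → X (fun x => (s / c * h x) ^ p) = s ^ p := by
    intro c hc0 hcT h hh hc
    simp_rw [ENNReal.mul_rpow_of_nonneg _ _ hp0.le]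
    rw [hX.const_mul (ENNReal.rpow_ne_top_of_nonneg hp0.le (ENNReal.div_ne_top hsT hc0))
      (hh.pow_const p), ← convexification_rpow (X := X) hp0, hc,
      ← ENNReal.mul_rpow_of_nonneg _ _ hp0.le, ENNReal.div_mul_cancel hc0 hcT]
  have hfm : Measurable fun x => (s / a * f x) ^ p := (hf.const_mul _).pow_const p
  have hgm : Measurable fun x => (s / b * g x) ^ p := (hg.const_mul _).pow_const p
  have hafin : a / s ≠ ∞ := ENNReal.div_ne_top haT hs0
  have hbfin : b / s ≠ ∞ := ENNReal.div_ne_top hbT hs0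
  rw [convexification_le_iff hp0]
  calc X (fun x => (f + g) x ^ p)
      ≤ X ((fun x => a / s * (s / a * f x) ^ p) + fun x => b / s * (s / b * g x) ^ p) := by
        refine hX.mono' ((hf.add hg).pow_const p) ((hfm.const_mul _).add (hgm.const_mul _))
          fun x => ?_
        have := ENNReal.rpow_arith_mean_le_arith_mean2_rpow (a / s) (b / s) (s / a * f x)
          (s / b * g x) hw hp
        rwa [hcancel a ha0 haT, hcancel b hb0 hbT] at this
    _ ≤ a / s * s ^ p + b / s * s ^ p := by
        refine (hX.add_le _ _ (hfm.const_mul _) (hgm.const_mul _)).trans ?_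
        rw [hX.const_mul hafin hfm, hX.const_mul hbfin hgm, hpow a ha0 haT f hf rfl,
          hpow b hb0 hbT g hg rfl]
    _ = s ^ p := by rw [← add_mul, hw, one_mul]

/-- The `p`-convexification of an r.i. function norm is an r.i. function norm. -/
theorem IsRINorm.convexification (hX : IsRINorm μ X) (hp : 1 ≤ p) :
    IsRINorm μ (convexification X p) := by
  have hp0 : 0 < p := by linarith
  have hmono : ∀ f g : α → ℝ≥0∞, X (fun x => f x ^ p) ≤ X (fun x => g x ^ p) →
      HajlaszBesov.convexification X p f ≤ HajlaszBesov.convexification X p g := fun f g h => by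
    rwa [convexification_le_iff hp0, convexification_rpow hp0]
  have hsmul : ∀ (a : ℝ≥0) (f : α → ℝ≥0∞), Measurable f →
      HajlaszBesov.convexification X p (fun x => a * f x) =
        a * HajlaszBesov.convexification X p f := fun a f hf => by
    simp_rw [HajlaszBesov.convexification, ENNReal.mul_rpow_of_nonneg _ _ hp0.le]
    rw [hX.const_mul (ENNReal.rpow_ne_top_of_nonneg hp0.le ENNReal.coe_ne_top) (hf.pow_const p),
      ENNReal.mul_rpow_of_nonneg _ _ (by positivity), ← ENNReal.rpow_mul,
      mul_one_div_cancel hp0.ne', ENNReal.rpow_one]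
  have hzero : ∀ f : α → ℝ≥0∞, Measurable f →
      (HajlaszBesov.convexification X p f = 0 ↔ f =ᵐ[μ] 0) := fun f hf => by
    rw [HajlaszBesov.convexification, ENNReal.rpow_eq_zero_iff_of_pos (by positivity),
      hX.eq_zero_iff _ (hf.pow_const p)]
    refine Filter.eventually_congr (Filter.Eventually.of_forall fun x => ?_)
    simp [hp0, hp0.not_gt]
  refine ⟨⟨fun f g hf hg => hX.convexification_add_le hp hf hg, hsmul, hzero,
    fun f g hf hg h => ?_, fun F hF hFm => ?_, fun A hA hμA => ?_, fun A hA hμA => ?_⟩,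
    fun f g hf hg h => ?_⟩
  · refine hmono f g (hX.mono _ _ (hf.pow_const p) (hg.pow_const p) ?_)
    filter_upwards [h] with x hx
    gcongr
  · have h1 : ∀ x, (⨆ n, F n x) ^ p = ⨆ n, F n x ^ p := fun x =>
      (ENNReal.orderIsoRpow p hp0).map_iSup fun n => F n x
    have h2 : ∀ u : ℕ → ℝ≥0∞, (⨆ n, u n) ^ (1 / p) = ⨆ n, u n ^ (1 / p) := fun u =>
      (ENNReal.orderIsoRpow (1 / p) (by positivity)).map_iSup u
    simp_rw [HajlaszBesov.convexification, h1]
    rw [hX.fatou _ (fun n => (hF n).pow_const p), h2]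
    intro m n hmn x
    have := hFm hmn x
    dsimp only
    gcongr
  · have : (fun x => (A.indicator (1 : α → ℝ≥0∞) x) ^ p) = A.indicator 1 := by
      ext x
      by_cases hx : x ∈ A <;> simp [hx, hp0]
    rw [HajlaszBesov.convexification, this]
    exact ENNReal.rpow_lt_top_of_nonneg (by positivity) (hX.indicator_lt_top A hA hμA).ne
  · obtain ⟨C, hC⟩ := hX.lintegral_le A hA hμA
    refine ⟨(μ A).toNNReal + C + 1, fun f hf => ?_⟩
    set a := HajlaszBesov.convexification X p f with ha
    rcases eq_or_ne a ∞ with h | haT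
    · rw [h, ENNReal.mul_top]
      · exact le_top
      · simp
    rcases eq_or_ne a 0 with h | ha0
    · have h0 := (hzero f hf).1 h
      rw [lintegral_congr_ae (ae_restrict_of_ae h0)]
      simp
    -- after normalisation, `f ≤ 1 + f ^ p` suffices
    have hle : ∀ y : ℝ≥0∞, y ≤ 1 + y ^ p := fun y => by
      rcases le_total y 1 with hy | hy
      · exact hy.trans le_self_add
      · refine le_trans ?_ le_add_self
        simpa using ENNReal.rpow_le_rpow_of_exponent_le hy hp
    have hai : a⁻¹ ≠ ∞ := ENNReal.inv_ne_top.2 ha0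
    have hXf : X (fun x => (a⁻¹ * f x) ^ p) = 1 := by
      simp_rw [ENNReal.mul_rpow_of_nonneg _ _ hp0.le]
      rw [hX.const_mul (ENNReal.rpow_ne_top_of_nonneg hp0.le hai) (hf.pow_const p),
        ← convexification_rpow (X := X) hp0, ← ha, ← ENNReal.mul_rpow_of_nonneg _ _ hp0.le,
        ENNReal.inv_mul_cancel ha0 haT, ENNReal.one_rpow]
    have key : ∫⁻ x in A, a⁻¹ * f x ∂μ ≤ μ A + C := by
      calc ∫⁻ x in A, a⁻¹ * f x ∂μ
          ≤ ∫⁻ x in A, (1 + (a⁻¹ * f x) ^ p) ∂μ := lintegral_mono fun x => hle _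
        _ = μ A + ∫⁻ x in A, (a⁻¹ * f x) ^ p ∂μ := by
            rw [lintegral_add_left measurable_const, setLIntegral_const, one_mul]
        _ ≤ μ A + C * X (fun x => (a⁻¹ * f x) ^ p) := by
            gcongr
            exact hC _ ((hf.const_mul _).pow_const p)
        _ = _ := by rw [hXf, mul_one]
    rw [lintegral_const_mul _ hf, ENNReal.inv_mul_le_iff ha0 haT] at key
    refine key.trans ?_
    rw [mul_comm a, ENNReal.coe_add, ENNReal.coe_add, ENNReal.coe_toNNReal hμA.ne]
    exact mul_le_mul_left le_self_add _
  · refine hmono f g (hX.rearrangement_mono _ _ (hf.pow_const p) (hg.pow_const p) ?_)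
    filter_upwards [h] with s hs
    rw [rearrangement_rpow hp0, rearrangement_rpow hp0]
    gcongr

end Convexification

/-! ### Identification of the interpolation spaces -/

section Interpolation

variable {Ω : Type*} [MetricSpace Ω] [MeasurableSpace Ω] {μ : Measure Ω}
  {X : (Ω → ℝ≥0∞) → ℝ≥0∞} {E : (ℝ → ℝ≥0∞) → ℝ≥0∞} {b : ℝ → ℝ} {θ : ℝ}

/-- If the weighted norm of `e` in `Ẽ` is finite, then so is `e` at some point of `(0, ∞)`. -/
theorem exists_ne_top_of_tildeNorm_lt_top (hE : IsParameter E) (hb : IsSlowlyVarying b)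
    {e : ℝ → ℝ≥0∞} (h : tildeNorm E (fun t => ENNReal.ofReal (t ^ (-θ) * b t) * e t) < ∞) :
    ∃ t, 0 < t ∧ e t < ∞ := by
  by_contra! hcon
  refine homMeasure_Ico_pos one_pos one_lt_two
    (measure_mono_null (fun t ht => ?_) (homMeasure_eq_top hE h))
  have ht0 : 0 < t := one_pos.trans_le ht.1
  have hw : 0 < t ^ (-θ) * b t := mul_pos (Real.rpow_pos_of_pos ht0 _) (hb.pos t ht0)
  change _ * e t = ∞
  rw [top_le_iff.1 (hcon t ht0), ENNReal.mul_top (ENNReal.ofReal_pos.2 hw).ne']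

theorem tildeNorm_weight_le (hE : IsParameter E) (w : ℝ → ℝ≥0∞) {C : ℝ≥0} {e e' : ℝ → ℝ≥0∞}
    (h : ∀ t, 0 < t → e t ≤ C * e' t) :
    tildeNorm E (fun t => w t * e t) ≤ C * tildeNorm E (fun t => w t * e' t) := by
  rw [← tildeNorm_const_mul hE ENNReal.coe_ne_top]
  refine tildeNorm_mono hE fun t ht => ?_
  calc w t * e t ≤ w t * (C * e' t) := by gcongr; exact h t ht
    _ = _ := by ring

/-- The homogeneous Hajłasz–Besov space over an arbitrary r.i. space is an interpolation space. -/
theorem IsRDSpace.homHajlaszBesov_eqEquiv [BorelSpace Ω] [NullSingletonClass μ]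
    (hΩ : IsRDSpace μ) (hX : IsRINorm μ X) (hE : IsParameter E) (hb : IsSlowlyVarying b)
    (hθ₀ : 0 < θ) (hθ₁ : θ < 1) :
    (homHajlaszBesov μ X θ b E).EqEquiv
      (realInterpolation (functionSpace μ X) (homHajlaszSobolev μ X) θ b E) := by
  have := hΩ.secondCountableTopology
  have := hΩ.isLocallyFiniteMeasure
  obtain ⟨l, hl, CH, hH⟩ := exists_hardy hE hb hθ₁ hθ₀
  obtain ⟨C₁, h₁⟩ := hΩ.exists_modulus_le_peetreK hX
  obtain ⟨C₂, h₂⟩ := hΩ.exists_decomposition hX hl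
  have hlow : ∀ f, (homHajlaszBesov μ X θ b E).nrm f ≤ C₁ *
      (realInterpolation (functionSpace μ X) (homHajlaszSobolev μ X) θ b E).nrm f := fun f =>
    tildeNorm_weight_le hE _ (h₁ f)
  have hK : ∀ f ∈ Lp ℝ 1 μ ⊔ Lp ℝ ∞ μ, ∀ t, 0 < t →
      peetreK (functionSpace μ X) (homHajlaszSobolev μ X) f t ≤ (2 * C₂ + 1 : ℝ≥0) *
        ∑' j : ℕ, ENNReal.ofReal ((l ^ j)⁻¹) * modulus μ X f (l ^ j * t) := by
    intro f hf t ht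
    rcases eq_or_ne (∑' j : ℕ, ENNReal.ofReal ((l ^ j)⁻¹) * modulus μ X f (l ^ j * t)) ∞ with h | h
    · rw [h, ENNReal.mul_top (by simp)]
      exact le_top
    obtain ⟨f₀, hf₀, f₁, hf₁, hff, hn₀, hn₁⟩ := h₂ f t hf ht h.lt_top
    calc _ ≤ _ := by rw [hff]; exact peetreK_le t hf₀ hf₁
      _ ≤ _ := add_le_add hn₀ hn₁
      _ = (2 * C₂ : ℝ≥0) * ∑' j : ℕ, ENNReal.ofReal ((l ^ j)⁻¹) * modulus μ X f (l ^ j * t) := by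
        push_cast; ring
      _ ≤ _ := by gcongr; exact le_self_add
  have hup : ∀ f ∈ Lp ℝ 1 μ ⊔ Lp ℝ ∞ μ,
      (realInterpolation (functionSpace μ X) (homHajlaszSobolev μ X) θ b E).nrm f ≤
        ((2 * C₂ + 1) * CH : ℝ≥0) * (homHajlaszBesov μ X θ b E).nrm f := fun f hf => by
    refine (tildeNorm_weight_le hE _ (hK f hf)).trans ?_
    rw [ENNReal.coe_mul, mul_assoc]
    gcongr
    exact hH _
  refine ⟨Subset.antisymm ?_ ?_, C₁ + (2 * C₂ + 1) * CH, ?_⟩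
  · rintro f ⟨hf, hfin⟩
    refine ⟨?_, (hup f hf).trans_lt (ENNReal.mul_lt_top ENNReal.coe_lt_top hfin)⟩
    obtain ⟨t, ht, hS⟩ := exists_ne_top_of_tildeNorm_lt_top hE hb
      ((hH (modulus μ X f)).trans_lt (ENNReal.mul_lt_top ENNReal.coe_lt_top hfin))
    obtain ⟨f₀, hf₀, f₁, hf₁, hff, -⟩ := h₂ f t hf ht hS
    exact ⟨f₀, hf₀, f₁, hf₁, hff⟩
  · rintro f ⟨⟨f₀, hf₀, f₁, hf₁, rfl⟩, hfin⟩
    exact ⟨add_mem (mem_sup_of_mem_functionSpace hΩ hX hf₀) hf₁.1,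
      (hlow _).trans_lt (ENNReal.mul_lt_top ENNReal.coe_lt_top hfin)⟩
  · rintro f ⟨hf, -⟩
    constructor
    · refine (hlow f).trans ?_
      gcongr
      exact le_self_add
    · refine (hup f hf).trans ?_
      gcongr
      exact le_add_self

theorem zero_mem_hajlaszSobolev (hX : IsRINorm μ X) :
    (0 : Ω →ₘ[μ] ℝ) ∈ (hajlaszSobolev μ X).carrier ∧ (hajlaszSobolev μ X).nrm 0 = 0 := by
  have h0 : ((0 : Ω →ₘ[μ] ℝ) : Ω → ℝ) =ᵐ[μ] 0 := AEEqFun.coeFn_zero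
  have hs : (functionSpace μ X).nrm 0 = 0 := by
    refine (hX.eq_zero_iff _ (measurable_coeFn_enorm _)).2 ?_
    filter_upwards [h0] with x hx
    simp [hx]
  have hm : (homHajlaszSobolev μ X).nrm 0 = 0 := by
    have hg : IsOneGradient μ (0 : Ω →ₘ[μ] ℝ) fun _ => 0 := by
      refine ⟨measurable_const, _, ae_iff.1 h0, fun x hx y hy => ?_⟩
      rw [not_not.1 hx, not_not.1 hy]
      simp
    refine nonpos_iff_eq_zero.1 ((iInf₂_le _ hg).trans (le_of_eq ?_))
    simpa using hX.map_zero
  refine ⟨⟨⟨zero_mem _, ?_⟩, ?_⟩, ?_⟩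
  · exact hm.trans_lt ENNReal.zero_lt_top
  · exact hs.trans_lt ENNReal.zero_lt_top
  · change (functionSpace μ X).nrm 0 + (homHajlaszSobolev μ X).nrm 0 = 0
    rw [hs, hm, add_zero]

/-- The inhomogeneous Hajłasz–Besov space over an arbitrary r.i. space is an interpolation space.
The bounds for the homogeneous couple are used for `t < 1`, while the norm in `X` takes over for
`t ≥ 1`. -/
theorem IsRDSpace.hajlaszBesov_eqEquiv [BorelSpace Ω] [NullSingletonClass μ]
    (hΩ : IsRDSpace μ) (hX : IsRINorm μ X) (hE : IsParameter E) (hb : IsSlowlyVarying b)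
    (hθ₀ : 0 < θ) (hθ₁ : θ < 1) :
    (hajlaszBesov μ X θ b E).EqEquiv
      (realInterpolation (functionSpace μ X) (hajlaszSobolev μ X) θ b E) := by
  have := hΩ.secondCountableTopology
  have := hΩ.isLocallyFiniteMeasure
  obtain ⟨l, hl, CH, hH⟩ := exists_hardy hE hb hθ₁ hθ₀
  obtain ⟨C₁, h₁⟩ := hΩ.exists_modulus_le_peetreK hX
  obtain ⟨C₂, h₂⟩ := hΩ.exists_decomposition hX hl
  obtain ⟨C₃, -, h₃, -⟩ := hΩ.exists_modulus_le hX
  have hl0 : 0 < l := by linarith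
  set w : ℝ → ℝ≥0∞ := fun t => ENNReal.ofReal (t ^ (-θ) * b t) with hw
  set K : (Ω →ₘ[μ] ℝ) → ℝ → ℝ≥0∞ := peetreK (functionSpace μ X) (hajlaszSobolev μ X) with hKdef
  obtain ⟨T, hT⟩ : ∃ T : ℝ≥0, (T : ℝ≥0∞) = tildeNorm E ((Ici (1 : ℝ)).indicator w) :=
    ⟨_, ENNReal.coe_toNNReal (tildeNorm_tail_lt_top hE hb hθ₀).ne⟩
  -- the tail of the weight over `[1, 2)` recovers the norm in `X`
  obtain ⟨c, hc⟩ : ∃ c : ℝ≥0, (c : ℝ≥0∞) = (tildeNorm E ((Ico (1 : ℝ) 2).indicator w))⁻¹ :=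
    ⟨_, ENNReal.coe_toNNReal (ENNReal.inv_ne_top.2 (tildeNorm_Ico_ne_zero hE hb hθ₁))⟩
  have hsub : (hajlaszSobolev μ X).carrier ⊆ (homHajlaszSobolev μ X).carrier := inter_subset_left
  have hmodK : ∀ (f : Ω →ₘ[μ] ℝ) t, 0 < t → modulus μ X f t ≤ C₁ * K f t := fun f t ht => by
    refine (h₁ f t ht).trans ?_
    gcongr
    exact peetreK_anti hsub (fun f => le_add_self) f t
  have hnK : ∀ f t, 1 ≤ t → (functionSpace μ X).nrm f ≤ K f t := fun f t ht => by
    have h : (functionSpace μ X).nrm f ≤ ((1 : ℝ≥0) : ℝ≥0∞) * K f t := by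
      refine le_mul_peetreK one_ne_zero fun f₀ _ f₁ _ hf => ?_
      rw [hf, ENNReal.coe_one, one_mul]
      refine (functionSpace_nrm_add_le hX f₀ f₁).trans ?_
      gcongr
      calc (functionSpace μ X).nrm f₁ ≤ (hajlaszSobolev μ X).nrm f₁ := le_self_add
        _ ≤ _ := le_mul_of_one_le_left zero_le (ENNReal.one_le_ofReal.2 ht)
    simpa using h
  have hKn : ∀ f ∈ (functionSpace μ X).carrier, ∀ t, K f t ≤ (functionSpace μ X).nrm f := by
    intro f hf t
    obtain ⟨h0, h0'⟩ := zero_mem_hajlaszSobolev (μ := μ) hX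
    have := peetreK_le t hf h0
    rwa [add_zero, h0', mul_zero, add_zero] at this
  have hlow₁ : ∀ f : Ω →ₘ[μ] ℝ, tildeNorm E (fun t => w t * modulus μ X f t) ≤
      C₁ * tildeNorm E (fun t => w t * K f t) := fun f => tildeNorm_weight_le hE w (hmodK f)
  have hlow : ∀ f ∈ (functionSpace μ X).carrier, (hajlaszBesov μ X θ b E).nrm f ≤
      (C₁ + c : ℝ≥0) * tildeNorm E (fun t => w t * K f t) := by
    intro f hf
    have hf' : (functionSpace μ X).nrm f ≠ ∞ := ne_of_lt hf
    rw [ENNReal.coe_add, add_mul]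
    refine add_le_add ?_ ?_
    · refine le_trans (tildeNorm_mono hE fun t _ => ?_) (hlow₁ f)
      exact indicator_le_self' (fun _ _ => zero_le) t
    · have hI : tildeNorm E ((Ico (1 : ℝ) 2).indicator w) ≠ ∞ := by
        refine ne_of_lt (lt_of_le_of_lt (tildeNorm_mono hE fun t _ => ?_)
          (tildeNorm_tail_lt_top hE hb hθ₀))
        exact indicator_le_indicator_of_subset Ico_subset_Ici_self (fun _ => zero_le) t
      rw [hc, ← ENNReal.div_eq_inv_mul, ENNReal.le_div_iff_mul_le
        (Or.inl (tildeNorm_Ico_ne_zero hE hb hθ₁)) (Or.inl hI), ← tildeNorm_const_mul hE hf']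
      refine tildeNorm_mono hE fun t _ => ?_
      by_cases ht : t ∈ Ico (1 : ℝ) 2
      · rw [indicator_of_mem ht, mul_comm]
        gcongr
        exact hnK f t ht.1
      · simp [ht]
  -- for `t ≥ 1` the modulus is replaced by a multiple of the norm in `X`
  set e : (Ω →ₘ[μ] ℝ) → ℝ → ℝ≥0∞ := fun f t => (Ioo (0 : ℝ) 1).indicator (modulus μ X f) t +
    (Ici (1 : ℝ)).indicator (fun _ => (C₃ + 1) * (functionSpace μ X).nrm f) t with he
  have hKe : ∀ f ∈ (functionSpace μ X).carrier, ∀ t, 0 < t → K f t ≤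
      (3 * C₂ + 1 + l.toNNReal : ℝ≥0) *
        ∑' j : ℕ, ENNReal.ofReal ((l ^ j)⁻¹) * e f (l ^ j * t) := by
    intro f hf t ht
    set S := ∑' j : ℕ, ENNReal.ofReal ((l ^ j)⁻¹) * e f (l ^ j * t) with hS
    have he1 : ∀ s, 1 ≤ s → (functionSpace μ X).nrm f ≤ e f s := fun s hs => by
      simp only [he]
      rw [indicator_of_mem (show s ∈ Ici (1 : ℝ) from hs)]
      exact le_add_left (le_mul_of_one_le_left zero_le le_add_self)
    rcases le_or_gt 1 t with ht1 | ht1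
    · calc K f t ≤ (functionSpace μ X).nrm f := hKn f hf t
        _ ≤ e f t := he1 t ht1
        _ = ENNReal.ofReal ((l ^ 0)⁻¹) * e f (l ^ 0 * t) := by simp
        _ ≤ S := ENNReal.le_tsum (f := fun j : ℕ => ENNReal.ofReal ((l ^ j)⁻¹) * e f (l ^ j * t)) 0
        _ ≤ _ := by
          refine le_mul_of_one_le_left zero_le ?_
          exact_mod_cast le_add_right le_add_self
    have hmS : ∑' j : ℕ, ENNReal.ofReal ((l ^ j)⁻¹) * modulus μ X f (l ^ j * t) ≤ S := by
      refine ENNReal.tsum_le_tsum fun j => ?_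
      gcongr
      have hs : 0 < l ^ j * t := by positivity
      generalize l ^ j * t = s at hs
      simp only [he]
      rcases lt_or_ge s 1 with h | h
      · rw [indicator_of_mem (show s ∈ Ioo (0 : ℝ) 1 from ⟨hs, h⟩)]
        exact le_self_add
      · rw [indicator_of_mem (show s ∈ Ici (1 : ℝ) from h)]
        refine le_add_left ((h₃ f s f.measurable hs).trans ?_)
        exact mul_le_mul_left le_self_add _
    -- the first `k` with `l ^ (k + 1) t ≥ 1` gives a term comparable with `t ‖f‖`
    have hnS : ENNReal.ofReal t * (functionSpace μ X).nrm f ≤ ENNReal.ofReal l * S := by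
      obtain ⟨k, hk1, hk2⟩ := exists_nat_pow_near ((one_le_inv₀ ht).2 ht1.le)
        (show 1 < l by linarith)
      have h1 : 1 ≤ l ^ (k + 1) * t := by
        rw [inv_lt_iff_one_lt_mul₀ ht] at hk2
        exact hk2.le
      have hlk : 0 < l ^ k := by positivity
      have h2 : t ≤ l * (l ^ (k + 1))⁻¹ := by
        rw [pow_succ', mul_inv, ← mul_assoc, mul_inv_cancel₀ hl0.ne', one_mul]
        rwa [le_inv_comm₀ hlk ht] at hk1
      calc ENNReal.ofReal t * (functionSpace μ X).nrm f
          ≤ ENNReal.ofReal (l * (l ^ (k + 1))⁻¹) * e f (l ^ (k + 1) * t) := by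
            gcongr
            exact he1 _ h1
        _ = ENNReal.ofReal l * (ENNReal.ofReal ((l ^ (k + 1))⁻¹) * e f (l ^ (k + 1) * t)) := by
            rw [ENNReal.ofReal_mul hl0.le, mul_assoc]
        _ ≤ _ := by
            gcongr
            exact ENNReal.le_tsum
              (f := fun j : ℕ => ENNReal.ofReal ((l ^ j)⁻¹) * e f (l ^ j * t)) (k + 1)
    rcases eq_or_ne S ∞ with h | h
    · rw [h, ENNReal.mul_top (by simp)]
      exact le_top
    obtain ⟨f₀, hf₀, f₁, hf₁, hff, hn₀, hn₁⟩ := h₂ f t (mem_sup_of_mem_functionSpace hΩ hX hf) ht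
      (hmS.trans_lt h.lt_top)
    have hn₀' : (functionSpace μ X).nrm f₀ ≤ C₂ * S := hn₀.trans (by gcongr)
    have hn₁' : ENNReal.ofReal t * (homHajlaszSobolev μ X).nrm f₁ ≤ C₂ * S :=
      hn₁.trans (by gcongr)
    have hn : (functionSpace μ X).nrm f₁ ≤
        (functionSpace μ X).nrm f + (functionSpace μ X).nrm f₀ := by
      have := functionSpace_nrm_sub_le hX f f₀
      rwa [hff, add_sub_cancel_left, ← hff] at this
    have hf₁X : f₁ ∈ (functionSpace μ X).carrier :=
      hn.trans_lt (ENNReal.add_lt_top.2 ⟨hf, hf₀⟩)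
    have ht1' : ENNReal.ofReal t ≤ 1 := ENNReal.ofReal_le_one.2 ht1.le
    calc K f t ≤ (functionSpace μ X).nrm f₀ + ENNReal.ofReal t * (hajlaszSobolev μ X).nrm f₁ := by
          rw [hff]
          exact peetreK_le t hf₀ ⟨hf₁, hf₁X⟩
      _ = (functionSpace μ X).nrm f₀ + (ENNReal.ofReal t * (functionSpace μ X).nrm f₁ +
            ENNReal.ofReal t * (homHajlaszSobolev μ X).nrm f₁) := by rw [← mul_add]; rfl
      _ ≤ (functionSpace μ X).nrm f₀ + (ENNReal.ofReal t * ((functionSpace μ X).nrm f +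
            (functionSpace μ X).nrm f₀) +
            ENNReal.ofReal t * (homHajlaszSobolev μ X).nrm f₁) := by gcongr
      _ ≤ C₂ * S + ((ENNReal.ofReal l * S + 1 * (C₂ * S)) + C₂ * S) := by
          rw [mul_add]
          gcongr
      _ = ((3 * C₂ + l.toNNReal : ℝ≥0) : ℝ≥0∞) * S := by
          rw [ENNReal.ofReal]; push_cast; ring
      _ ≤ _ := by
          refine mul_le_mul_left (ENNReal.coe_le_coe.2 ?_) _
          rw [add_right_comm]
          exact le_self_add
  set C₄ : ℝ≥0 := (3 * C₂ + 1 + l.toNNReal) * (CH * (4 * (1 + (C₃ + 1) * T))) with hC₄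
  have hup : ∀ f ∈ (functionSpace μ X).carrier, tildeNorm E (fun t => w t * K f t) ≤
      C₄ * (hajlaszBesov μ X θ b E).nrm f := by
    intro f hf
    have hf' : (functionSpace μ X).nrm f ≠ ∞ := ne_of_lt hf
    have hwe : tildeNorm E (fun t => w t * e f t) ≤
        (4 * (1 + (C₃ + 1) * T) : ℝ≥0) * (hajlaszBesov μ X θ b E).nrm f := by
      have h1 : ∀ t, w t * e f t =
          (Ioo (0 : ℝ) 1).indicator (fun t => w t * modulus μ X f t) t +
          ((C₃ + 1) * (functionSpace μ X).nrm f) * (Ici (1 : ℝ)).indicator w t := by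
        intro t
        simp only [he, mul_add, indicator_apply]
        split_ifs <;> ring
      simp_rw [h1]
      refine (tildeNorm_add_le hE _ _).trans ?_
      rw [tildeNorm_const_mul hE (ENNReal.mul_ne_top (by simp) hf'), ← hT]
      set A := tildeNorm E ((Ioo (0 : ℝ) 1).indicator fun t => w t * modulus μ X f t) with hA
      set B := (functionSpace μ X).nrm f with hB
      change _ ≤ _ * (A + B)
      calc 4 * (A + (C₃ + 1) * B * T) ≤ 4 * (A + (C₃ + 1) * B * T) +
            4 * (B + (C₃ + 1) * T * A) := le_self_add
        _ = _ := by push_cast; ring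
    calc tildeNorm E (fun t => w t * K f t) ≤ _ := tildeNorm_weight_le hE w (hKe f hf)
      _ ≤ (3 * C₂ + 1 + l.toNNReal : ℝ≥0) * (CH * ((4 * (1 + (C₃ + 1) * T) : ℝ≥0) *
            (hajlaszBesov μ X θ b E).nrm f)) := by
          gcongr
          exact (hH (e f)).trans (by gcongr)
      _ = _ := by simp only [hC₄, ENNReal.coe_mul, mul_assoc]
  refine ⟨Subset.antisymm ?_ ?_, C₁ + c + C₄, ?_⟩
  · rintro f ⟨⟨hf, hfin⟩, hfX⟩
    refine ⟨⟨f, hfX, 0, (zero_mem_hajlaszSobolev hX).1, (add_zero f).symm⟩, ?_⟩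
    refine (hup f hfX).trans_lt (ENNReal.mul_lt_top ENNReal.coe_lt_top ?_)
    refine ENNReal.add_lt_top.2 ⟨lt_of_le_of_lt (tildeNorm_mono hE fun t _ => ?_) hfin, hfX⟩
    exact indicator_le_self' (fun _ _ => zero_le) t
  · rintro f ⟨⟨f₀, hf₀, f₁, hf₁, hff⟩, hfin⟩
    have hfX : f ∈ (functionSpace μ X).carrier := by
      rw [hff]
      exact (functionSpace_nrm_add_le hX f₀ f₁).trans_lt (ENNReal.add_lt_top.2 ⟨hf₀, hf₁.2⟩)
    exact ⟨⟨mem_sup_of_mem_functionSpace hΩ hX hfX,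
      (hlow₁ f).trans_lt (ENNReal.mul_lt_top ENNReal.coe_lt_top hfin)⟩, hfX⟩
  · rintro f ⟨-, hfX⟩
    constructor
    · exact (hlow f hfX).trans (mul_le_mul_left (ENNReal.coe_le_coe.2 le_self_add) _)
    · exact (hup f hfX).trans (mul_le_mul_left (ENNReal.coe_le_coe.2 le_add_self) _)

end Interpolation

end HajlaszBesov

end

theorem mainTheorem3 {Ω : Type*} [MetricSpace Ω] [MeasurableSpace Ω] [BorelSpace Ω]
    (μ : Measure Ω) [NullSingletonClass μ] (hΩ : HajlaszBesov.IsRDSpace μ)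
    (X : (Ω → ℝ≥0∞) → ℝ≥0∞) (hX : HajlaszBesov.IsRINorm μ X) (p : ℝ) (hp : 1 ≤ p)
    (E : (ℝ → ℝ≥0∞) → ℝ≥0∞) (hE : HajlaszBesov.IsParameter E)
    (b : ℝ → ℝ) (hb : HajlaszBesov.IsSlowlyVarying b) (θ : ℝ) (hθ₀ : 0 < θ) (hθ₁ : θ < 1) :
    (HajlaszBesov.homHajlaszBesov μ (HajlaszBesov.convexification X p) θ b E).EqEquiv
      (HajlaszBesov.realInterpolation
        (HajlaszBesov.functionSpace μ (HajlaszBesov.convexification X p))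
        (HajlaszBesov.homHajlaszSobolev μ (HajlaszBesov.convexification X p)) θ b E) ∧
    (HajlaszBesov.hajlaszBesov μ (HajlaszBesov.convexification X p) θ b E).EqEquiv
      (HajlaszBesov.realInterpolation
        (HajlaszBesov.functionSpace μ (HajlaszBesov.convexification X p))
        (HajlaszBesov.hajlaszSobolev μ (HajlaszBesov.convexification X p)) θ b E) :=
  ⟨hΩ.homHajlaszBesov_eqEquiv (hX.convexification hp) hE hb hθ₀ hθ₁,
    hΩ.hajlaszBesov_eqEquiv (hX.convexification hp) hE hb hθ₀ hθ₁⟩
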